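/- Let $F$ be a field and let $E=(E^0,E^1,r,s)$ be a directed graph with $E^0\neq\emptyset$ that is row-finite, i.e. $s^{-1}(v)$ is finite for every $v\in E^0$. Let $L_F(E)$ be its Leavitt path algebra: the associative, not necessarily unital, $F$-algebra generated by the vertices $v\in E^0$, the edges $e\in E^1$ and the ghost edges $e^*$ $(e\in E^1)$, subject to $vw=\delta_{v,w}v$, $s(e)e=e=e\,r(e)$, $r(e)e^*=e^*=e^*s(e)$, $e^*f=\delta_{e,f}r(e)$, and $v=\sum_{s(e)=v}ee^*$ for every $v$ with $s^{-1}(v)\ne\emptyset$. It is $\mathbb Z$-graded by $\deg v=0$, $\deg e=1$, $\deg e^*=-1$. Let $M^{\mathrm{gr}}_E$ be the abelian monoid generated by the symbols $v(i)$ $(v\in E^0,\ i\in\mathbb Z)$ subject to $v(i)=\sum_{s(e)=v}r(e)(i+1)$ for every $i$ and every $v$ with $s^{-1}(v)\neq\emptyset$, with the action of $\mathbb Z$ given by ${}^n v(i)=v(i+n)$. Write $a\le b$ if $b=a+c$ for some $c\in M^{\mathrm{gr}}_E$, write $a<b$ (or $b>a$) if $a\le b$ and $a\ne b$, and call $a,b$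 comparable if $a\le b$ or $b\le a$. A $\mathbb Z$-order-ideal is a submonoid $I$ that is closed under the action and such that $a\le b\in I$ implies $a\in I$; $M^{\mathrm{gr}}_E$ is simple if its only $\mathbb Z$-order-ideals are $0$ and $M^{\mathrm{gr}}_E$. A nonzero ring is simple if its only two-sided ideals are $0$ and itself, and a nonzero graded ring is graded simple if its only graded two-sided ideals are $0$ and itself. An idempotent $e$ is infinite if $e=f+g$ with orthogonal idempotents $f,g$, $g\ne0$, and $e=xy$, $f=yx$ for some ring elements $x,y$. A ring is purely infinite simple if it is simple and each of its nonzero right ideals contains an infinite idempotent. Then: (i) $L_F(E)$ is graded simple if and only if $M^{\mathrm{gr}}_E$ is simple. (ii) $L_F(E)$ is simple if and only if $M^{\mathrm{gr}}_E$ is simple and, for every nonzero $a\in M^{\mathrm{gr}}_E$ and every integer $n<0$ such that ${}^na$ and $a$ are comparable, ${}^na>a$. (iii) $L_F(E)$ is purely infinite simple if and only if $M^{\mathrm{gr}}_E$ is simple; for every nonzero $a\in M^{\mathrm{gr}}_E$ and every integer $n<0$ such that ${}^na$ and $a$ are comparable, ${}^na>a$; and there are an $a\in M^{\mathrm{gr}}_E$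 and an integer $n<0$ with ${}^na>a$. (iv) If $E$ is finite (i.e. $E^0$ and $E^1$ are finite), then $L_F(E)$ is purely infinite simple if and only if $M^{\mathrm{gr}}_E$ is simple and for every nonzero $a\in M^{\mathrm{gr}}_E$ there is an integer $n<0$ with ${}^na>a$. -/

import Mathlib

universe u v w

/-! ### Directed graphs -/

/-- A directed graph with vertex set `V` and edge set `E`: each edge `e` points from its source
`s e` to its range `r e`. Loops and parallel edges are allowed. -/
structure DirGraph (V : Type u) (E : Type v) where
  s : E → V
  r : E → V

namespace DirGraph

variable {V : Type u} {E : Type v}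

/-- A graph is row-finite if every vertex emits only finitely many edges. -/
def RowFinite (G : DirGraph V E) : Prop :=
  ∀ x : V, {e : E | G.s e = x}.Finite

end DirGraph

/-! ### Monoids with a group action -/

section Monoids

variable {M : Type u} [AddCommMonoid M]

/-- The algebraic pre-order of an abelian monoid: `a ≤ b` if `b = a + c` for some `c`. -/
def AlgLE (a b : M) : Prop := ∃ c : M, b = a + c

/-- `a < b` means `a ≤ b` and `a ≠ b`. -/
def AlgLT (a b : M) : Prop := AlgLE a b ∧ a ≠ b

/-- Two elements are comparable if `a ≤ b` or `b ≤ a`. -/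
def AlgComparable (a b : M) : Prop := AlgLE a b ∨ AlgLE b a

variable (Γ : Type v) [Group Γ] [DistribMulAction Γ M]

/-- A `Γ`-order-ideal: a submonoid that is closed under the action of `Γ` and hereditary for the
algebraic pre-order. -/
def IsOrderIdeal (I : AddSubmonoid M) : Prop :=
  (∀ (γ : Γ) (a : M), a ∈ I → γ • a ∈ I) ∧ ∀ a b : M, AlgLE a b → b ∈ I → a ∈ I

/-- A `Γ`-monoid `M` is simple if its only `Γ`-order-ideals are `0` and `M`. -/
def IsSimpleMonoid (M : Type u) [AddCommMonoid M] [DistribMulAction Γ M] : Prop :=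
  ∀ I : AddSubmonoid M, IsOrderIdeal Γ I → I = ⊥ ∨ I = ⊤

end Monoids

/-! ### The graded graph monoid -/

namespace DirGraph

variable {V : Type u} {E : Type v}

/-- The defining relations of the graded graph monoid, on the free abelian monoid
`Multiset (V × ℤ)` on the symbols `x(i)`: one has `x(i) = ∑_{s(e) = x} r(e)(i + 1)` whenever
`x` emits at least one and only finitely many edges. -/
inductive GrRel (G : DirGraph V E) : Multiset (V × ℤ) → Multiset (V × ℤ) → Prop
  | expand (x : V) (i : ℤ) (hfin : {e : E | G.s e = x}.Finite)
      (hne : {e : E | G.s e = x}.Nonempty) :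
      GrRel G {(x, i)} (∑ e ∈ hfin.toFinset, {(G.r e, i + 1)})

/-- The congruence generated by the defining relations. -/
def grCon (G : DirGraph V E) : AddCon (Multiset (V × ℤ)) := addConGen (GrRel G)

/-- The graded graph monoid `M^gr` of a (row-finite) graph. -/
def GrMonoid (G : DirGraph V E) : Type u := (grCon G).Quotient

namespace GrMonoid

noncomputable instance (G : DirGraph V E) : AddCommMonoid (GrMonoid G) :=
  inferInstanceAs (AddCommMonoid (grCon G).Quotient)

/-- The generator `x(i)` of the graded graph monoid. -/
def of (G : DirGraph V E) (x : V) (i : ℤ) : GrMonoid G :=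
  (grCon G).mk' {(x, i)}

/-- The shift by `n` on the free abelian monoid, `x(i) ↦ x(i + n)`. -/
def shiftFree (V : Type u) (n : ℤ) : Multiset (V × ℤ) →+ Multiset (V × ℤ) :=
  Multiset.mapAddMonoidHom fun p => (p.1, p.2 + n)

theorem shiftFree_rel (G : DirGraph V E) (n : ℤ) :
    grCon G ≤ AddCon.ker (((grCon G).mk').comp (shiftFree V n)) := by
  refine AddCon.addConGen_le.2 ?_
  rintro _ _ ⟨x, i, hfin, hne⟩
  rw [AddCon.ker_apply]
  have h : grCon G {(x, i + n)} (∑ e ∈ hfin.toFinset, {(G.r e, i + n + 1)}) :=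
    AddConGen.Rel.of _ _ (GrRel.expand x (i + n) hfin hne)
  have h2 : (grCon G).mk' {(x, i + n)} =
      (grCon G).mk' (∑ e ∈ hfin.toFinset, {(G.r e, i + n + 1)}) := (AddCon.eq _).2 h
  simp only [AddMonoidHom.comp_apply, map_sum]
  simp only [shiftFree, Multiset.coe_mapAddMonoidHom, Multiset.map_singleton]
  rw [← map_sum]
  simpa only [add_right_comm i 1 n] using h2

/-- The shift by `n` on the graded graph monoid: the endomorphism with `x(i) ↦ x(i + n)`. -/
noncomputable def shift (G : DirGraph V E) (n : ℤ) : GrMonoid G →+ GrMonoid G :=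
  (grCon G).lift (((grCon G).mk').comp (shiftFree V n)) (shiftFree_rel G n)

theorem shift_of (G : DirGraph V E) (n : ℤ) (x : V) (i : ℤ) :
    shift G n (of G x i) = of G x (i + n) := rfl

theorem addHom_ext {G : DirGraph V E} {f g : GrMonoid G →+ GrMonoid G}
    (h : ∀ x i, f (of G x i) = g (of G x i)) : f = g := by
  have : f.comp (grCon G).mk' = g.comp (grCon G).mk' := by
    refine Multiset.addHom_ext ?_
    rintro ⟨x, i⟩
    exact h x i
  ext a
  obtain ⟨a, rfl⟩ := AddCon.mk'_surjective (c := grCon G) a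
  exact DFunLike.congr_fun this a

/-- The action of `ℤ` (written multiplicatively) on the graded graph monoid, `ⁿ(x(i)) = x(i + n)`. -/
noncomputable instance (G : DirGraph V E) :
    DistribMulAction (Multiplicative ℤ) (GrMonoid G) where
  smul n a := shift G n.toAdd a
  one_smul a := by
    have : shift G 0 = AddMonoidHom.id _ := addHom_ext fun x i => by simp [shift_of]
    exact DFunLike.congr_fun this a
  mul_smul m n a := by
    have : shift G (m.toAdd + n.toAdd) = (shift G m.toAdd).comp (shift G n.toAdd) :=
      addHom_ext fun x i => by
        simp only [shift_of, AddMonoidHom.comp_apply]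
        congr 1
        ring
    exact DFunLike.congr_fun this a
  smul_zero n := map_zero (shift G n.toAdd)
  smul_add n a b := map_add (shift G n.toAdd) a b

end GrMonoid

/-- `G.act n a` is the element `ⁿa`, the result of the action of `n` on `a`. -/
noncomputable def act (G : DirGraph V E) (n : ℤ) (a : GrMonoid G) : GrMonoid G :=
  Multiplicative.ofAdd n • a

/-! ### Leavitt path algebras -/

/-- The generators of a Leavitt path algebra: vertices, edges and ghost edges `e*`. -/
inductive LGen (V : Type u) (E : Type v) : Type (max u v)
  | vert (x : V)
  | edge (e : E)
  | ghost (e : E)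

/-- The degrees of the generators: vertices `0`, edges `1`, ghost edges `-1`. -/
def LGen.deg : LGen V E → ℤ
  | .vert _ => 0
  | .edge _ => 1
  | .ghost _ => -1

section Leavitt

variable (F : Type w) [Field F]

open Classical in
/-- The defining relations of the Leavitt path algebra, including the two Cuntz-Krieger
relations. The last one is imposed at the regular vertices, those that emit at least one and
only finitely many edges. -/
inductive LeavittRel (G : DirGraph V E) :
    FreeAlgebra F (LGen V E) → FreeAlgebra F (LGen V E) → Prop
  | vert_mul_vert (x y : V) :
      LeavittRel G (FreeAlgebra.ι F (.vert x) * FreeAlgebra.ι F (.vert y))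
        (if x = y then FreeAlgebra.ι F (.vert x) else 0)
  | source_mul_edge (e : E) :
      LeavittRel G (FreeAlgebra.ι F (.vert (G.s e)) * FreeAlgebra.ι F (.edge e))
        (FreeAlgebra.ι F (.edge e))
  | edge_mul_range (e : E) :
      LeavittRel G (FreeAlgebra.ι F (.edge e) * FreeAlgebra.ι F (.vert (G.r e)))
        (FreeAlgebra.ι F (.edge e))
  | range_mul_ghost (e : E) :
      LeavittRel G (FreeAlgebra.ι F (.vert (G.r e)) * FreeAlgebra.ι F (.ghost e))
        (FreeAlgebra.ι F (.ghost e))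
  | ghost_mul_source (e : E) :
      LeavittRel G (FreeAlgebra.ι F (.ghost e) * FreeAlgebra.ι F (.vert (G.s e)))
        (FreeAlgebra.ι F (.ghost e))
  | ghost_mul_edge (e f : E) :
      LeavittRel G (FreeAlgebra.ι F (.ghost e) * FreeAlgebra.ι F (.edge f))
        (if e = f then FreeAlgebra.ι F (.vert (G.r e)) else 0)
  | sum_edge_mul_ghost (x : V) (hfin : {e : E | G.s e = x}.Finite)
      (hne : {e : E | G.s e = x}.Nonempty) :
      LeavittRel G (FreeAlgebra.ι F (.vert x))
        (∑ e ∈ hfin.toFinset, FreeAlgebra.ι F (.edge e) * FreeAlgebra.ι F (.ghost e))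

/-- The unital algebra with the generators and relations of the Leavitt path algebra. As no
relation involves the unit, this is the Leavitt path algebra with a new unit adjoined. -/
abbrev LeavittUnitization (G : DirGraph V E) : Type (max u v w) :=
  RingQuot (LeavittRel F G)

/-- The image of a generator in the unital algebra. -/
def LeavittUnitization.gen (G : DirGraph V E) (x : LGen V E) : LeavittUnitization F G :=
  RingQuot.mkAlgHom F (LeavittRel F G) (FreeAlgebra.ι F x)

/-- The Leavitt path algebra `L_F(E)`: the associative, not necessarily unital `F`-algebra
generated by vertices, edges and ghost edges subject to `LeavittRel`. It is realized as the
non-unital subalgebra generated by these elements in the unital algebra with the same relations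
(all linear combinations of nonempty words in the generators). -/
abbrev LeavittPathAlgebra (G : DirGraph V E) : Type (max u v w) :=
  ↥(NonUnitalAlgebra.adjoin F (Set.range (LeavittUnitization.gen F G)))

namespace LeavittPathAlgebra

/-- The generators as elements of the Leavitt path algebra. -/
def gen (G : DirGraph V E) (x : LGen V E) : LeavittPathAlgebra F G :=
  ⟨LeavittUnitization.gen F G x, NonUnitalAlgebra.subset_adjoin F ⟨x, rfl⟩⟩

/-- `IsMonomial F G a n`: `a` is a product of generators whose degrees add up to `n`. -/
inductive IsMonomial (G : DirGraph V E) : LeavittPathAlgebra F G → ℤ → Prop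
  | gen (x : LGen V E) : IsMonomial G (gen F G x) x.deg
  | mul {a b : LeavittPathAlgebra F G} {m n : ℤ} :
      IsMonomial G a m → IsMonomial G b n → IsMonomial G (a * b) (m + n)

/-- The homogeneous component of degree `n` in the standard `ℤ`-grading. -/
def component (G : DirGraph V E) (n : ℤ) : Submodule F (LeavittPathAlgebra F G) :=
  Submodule.span F {a | IsMonomial F G a n}

end LeavittPathAlgebra

end Leavitt

end DirGraph

/-! ### Graded simple and purely infinite simple rings -/

section Rings

variable {R : Type u} [NonUnitalRing R]

/-- A two-sided ideal is graded, with respect to a family `A n` of homogeneous components, if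
each of its elements is a finite sum of homogeneous elements of the ideal. -/
def IsGradedIdeal {S : Type v} [SetLike S R] (A : ℤ → S) (I : TwoSidedIdeal R) : Prop :=
  ∀ a ∈ I, ∃ f : ℤ →₀ R, (∀ n, f n ∈ A n ∧ f n ∈ I) ∧ (f.sum fun _ b => b) = a

/-- A graded ring is graded simple if it is nonzero and its only graded two-sided ideals are `0`
and the whole ring. -/
def IsGradedSimple {S : Type v} [SetLike S R] (A : ℤ → S) : Prop :=
  Nontrivial R ∧ ∀ I : TwoSidedIdeal R, IsGradedIdeal A I → I = ⊥ ∨ I = ⊤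

/-- An idempotent `e` is infinite if `e = f + g` with orthogonal idempotents `f` and `g`, where
`g ≠ 0` and `f` is equivalent to `e`, that is, `e = x * y` and `f = y * x` for some `x`, `y`. -/
def IsInfiniteIdempotent (e : R) : Prop :=
  IsIdempotentElem e ∧ ∃ f g : R, IsIdempotentElem f ∧ IsIdempotentElem g ∧ f * g = 0 ∧
    g * f = 0 ∧ e = f + g ∧ g ≠ 0 ∧ ∃ x y : R, x * y = e ∧ y * x = f

/-- A ring (with local units) is purely infinite simple if it is simple and every nonzero right
ideal contains an infinite idempotent. -/
def IsPurelyInfiniteSimple (R : Type u) [NonUnitalRing R] : Prop :=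
  IsSimpleRing R ∧ ∀ J : AddSubgroup R, (∀ a ∈ J, ∀ b : R, a * b ∈ J) → J ≠ ⊥ →
    ∃ e ∈ J, IsInfiniteIdempotent e

end Rings

/-! Everything is translated into three conditions on the graph: (H) the only hereditary saturated
sets of vertices are the empty set and the full set; (L) every closed path has an exit; (C) some
closed path of positive length exists. Graded simplicity is (H), simplicity is (H) and (L), pure
infinite simplicity is (H), (L) and (C). On the monoid side, simplicity is (H), the strictness
condition on comparable negative shifts is (L), and given (L) the existence of some ⁿa > a with n <
0 is (C).

For the algebra, the engine is a reduction: a nonzero element, if it is homogeneous or if (L) holds,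
has a two-sided multiple equal to a vertex. So nonzero (graded) ideals contain vertices, and the
vertices in an ideal form a hereditary saturated set. Proper ideals come from representations on
branching systems: one kills exactly the vertices of a given hereditary saturated set, another (on
infinite paths) kills p - x for a closed path p at x without exits. These also show that vertices
are nonzero, so no basis of the algebra is needed. A closed path with an exit makes every vertex
leading to it an infinite idempotent, and under (H) every vertex leads to it. An acyclic graph gives
a union of finite-dimensional subalgebras, which has no infinite idempotents.

For the monoid, two multisets represent the same element only if their expansions to all high levels
coincide. Hence the monoid is cancellative, and inequalities between shifts become inclusions of
multisets. If ⁿa ≤ a with n < 0, counting elements forces a closed path without exits; if the graph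
is acyclic, a ≤ ⁿa forces a = 0. For the finite case, (H) and (C) exclude sinks, and Dickson's lemma
yields a ≤ ⁿa for some n < 0; conversely, periodicity along a closed path without exits contradicts
a < ⁿa. -/

namespace DirGraph

variable {V : Type u} {E : Type v} {F : Type w} [Field F] {G : DirGraph V E}

/-! ### Paths -/

/-- `G.IsPath x y p` says that the list of edges `p` is a path from `x` to `y`. -/
inductive IsPath (G : DirGraph V E) : V → V → List E → Prop
  | nil (x : V) : IsPath G x x []
  | cons {e : E} {y : V} {p : List E} : IsPath G (G.r e) y p → IsPath G (G.s e) y (e :: p)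

namespace IsPath

theorem append {x y z : V} {p q : List E} (hp : G.IsPath x y p) (hq : G.IsPath y z q) :
    G.IsPath x z (p ++ q) := by
  induction hp with
  | nil => exact hq
  | cons _ ih => exact (ih hq).cons

theorem single (e : E) : G.IsPath (G.s e) (G.r e) [e] := (IsPath.nil _).cons

theorem cons_iff {x y : V} {e : E} {p : List E} :
    G.IsPath x y (e :: p) ↔ x = G.s e ∧ G.IsPath (G.r e) y p := by
  constructor
  · rintro (_ | h)
    exact ⟨rfl, h⟩
  · rintro ⟨rfl, h⟩
    exact h.cons

theorem nil_iff {x y : V} : G.IsPath x y [] ↔ x = y := by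
  constructor
  · rintro ⟨⟩
    rfl
  · rintro rfl
    exact .nil _

theorem append_iff {x y : V} {p q : List E} :
    G.IsPath x y (p ++ q) ↔ ∃ z, G.IsPath x z p ∧ G.IsPath z y q := by
  induction p generalizing x with
  | nil => simp [nil_iff]
  | cons e p ih => simp [cons_iff, ih, and_assoc]

end IsPath

/-- Every closed path of positive length has an exit. -/
def ClosedPathsHaveExits (G : DirGraph V E) : Prop :=
  ∀ (x : V) (p : List E), G.IsPath x x p → p ≠ [] → ∃ e ∈ p, ∃ f : E, f ≠ e ∧ G.s f = G.s e

/-! ### The monomials of a Leavitt path algebra -/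

namespace LeavittUnitization

variable (F G)

/-- The image of a vertex. -/
def vert (x : V) : LeavittUnitization F G := gen F G (.vert x)
/-- The image of an edge. -/
def edge (e : E) : LeavittUnitization F G := gen F G (.edge e)
/-- The image of a ghost edge. -/
def ghost (e : E) : LeavittUnitization F G := gen F G (.ghost e)

/-- The Leavitt path algebra as a non-unital subalgebra. -/
abbrev lpa : NonUnitalSubalgebra F (LeavittUnitization F G) :=
  NonUnitalAlgebra.adjoin F (Set.range (gen F G))

variable {F G}

theorem vert_mem (x : V) : vert F G x ∈ lpa F G := NonUnitalAlgebra.subset_adjoin F ⟨_, rfl⟩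
theorem edge_mem (e : E) : edge F G e ∈ lpa F G := NonUnitalAlgebra.subset_adjoin F ⟨_, rfl⟩
theorem ghost_mem (e : E) : ghost F G e ∈ lpa F G := NonUnitalAlgebra.subset_adjoin F ⟨_, rfl⟩

theorem vert_mul_self (x : V) : vert F G x * vert F G x = vert F G x := by
  have h := RingQuot.mkAlgHom_rel F (LeavittRel.vert_mul_vert (F := F) (G := G) x x)
  simpa [gen, vert, edge, ghost] using h

theorem vert_mul_vert_of_ne {x y : V} (hxy : x ≠ y) : vert F G x * vert F G y = 0 := by
  have h := RingQuot.mkAlgHom_rel F (LeavittRel.vert_mul_vert (F := F) (G := G) x y)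
  simpa [gen, vert, hxy] using h

theorem source_mul_edge (e : E) : vert F G (G.s e) * edge F G e = edge F G e := by
  have h := RingQuot.mkAlgHom_rel F (LeavittRel.source_mul_edge (F := F) (G := G) e)
  simpa [gen, vert, edge, ghost] using h

theorem edge_mul_range (e : E) : edge F G e * vert F G (G.r e) = edge F G e := by
  have h := RingQuot.mkAlgHom_rel F (LeavittRel.edge_mul_range (F := F) (G := G) e)
  simpa [gen, vert, edge, ghost] using h

theorem range_mul_ghost (e : E) : vert F G (G.r e) * ghost F G e = ghost F G e := by
  have h := RingQuot.mkAlgHom_rel F (LeavittRel.range_mul_ghost (F := F) (G := G) e)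
  simpa [gen, vert, edge, ghost] using h

theorem ghost_mul_source (e : E) : ghost F G e * vert F G (G.s e) = ghost F G e := by
  have h := RingQuot.mkAlgHom_rel F (LeavittRel.ghost_mul_source (F := F) (G := G) e)
  simpa [gen, vert, edge, ghost] using h

theorem ghost_mul_edge_self (e : E) : ghost F G e * edge F G e = vert F G (G.r e) := by
  have h := RingQuot.mkAlgHom_rel F (LeavittRel.ghost_mul_edge (F := F) (G := G) e e)
  simpa [gen, vert, edge, ghost] using h

theorem ghost_mul_edge_of_ne {e f : E} (hef : e ≠ f) : ghost F G e * edge F G f = 0 := by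
  have h := RingQuot.mkAlgHom_rel F (LeavittRel.ghost_mul_edge (F := F) (G := G) e f)
  simpa [gen, edge, ghost, hef] using h

theorem vert_eq_sum (x : V) (hfin : {e : E | G.s e = x}.Finite)
    (hne : {e : E | G.s e = x}.Nonempty) :
    vert F G x = ∑ e ∈ hfin.toFinset, edge F G e * ghost F G e := by
  have h := RingQuot.mkAlgHom_rel F
    (LeavittRel.sum_edge_mul_ghost (F := F) (G := G) x hfin hne)
  simpa [gen, vert, edge, ghost] using h

theorem vert_mul_edge_of_ne {x : V} {e : E} (h : x ≠ G.s e) : vert F G x * edge F G e = 0 := by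
  rw [← source_mul_edge, ← mul_assoc, vert_mul_vert_of_ne h, zero_mul]

theorem edge_mul_vert_of_ne {x : V} {e : E} (h : G.r e ≠ x) : edge F G e * vert F G x = 0 := by
  rw [← edge_mul_range, mul_assoc, vert_mul_vert_of_ne h, mul_zero]

theorem ghost_mul_vert_of_ne {x : V} {e : E} (h : G.s e ≠ x) : ghost F G e * vert F G x = 0 := by
  rw [← ghost_mul_source, mul_assoc, vert_mul_vert_of_ne h, mul_zero]

variable (F G)

/-- The product of the edges of a path. -/
def pathElt (p : List E) : LeavittUnitization F G := (p.map (edge F G)).prod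

/-- The product of the ghost edges of a path, in reverse order. -/
def ghostElt (p : List E) : LeavittUnitization F G := (p.map (ghost F G)).reverse.prod

variable {F G}

@[simp] theorem pathElt_nil : pathElt F G [] = 1 := rfl
@[simp] theorem ghostElt_nil : ghostElt F G [] = 1 := rfl

theorem pathElt_cons (e : E) (p : List E) :
    pathElt F G (e :: p) = edge F G e * pathElt F G p := by simp [pathElt]

theorem ghostElt_cons (e : E) (p : List E) :
    ghostElt F G (e :: p) = ghostElt F G p * ghost F G e := by simp [ghostElt]

theorem pathElt_append (p q : List E) :
    pathElt F G (p ++ q) = pathElt F G p * pathElt F G q := by simp [pathElt]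

theorem ghostElt_append (p q : List E) :
    ghostElt F G (p ++ q) = ghostElt F G q * ghostElt F G p := by simp [ghostElt]

/-- The factor `vert F G y` is carried along because `pathElt F G []` is the adjoined unit; with it
the empty path at `y` becomes `y` and the product lies in `lpa F G`. -/
theorem vert_mul_pathElt {x y : V} {p : List E} (h : G.IsPath x y p) :
    vert F G x * (pathElt F G p * vert F G y) = pathElt F G p * vert F G y := by
  cases h with
  | nil => simp [vert_mul_self]
  | cons h => rw [pathElt_cons, mul_assoc, ← mul_assoc, source_mul_edge]

theorem vert_mul_pathElt_of_ne {x y z : V} {p : List E} (h : G.IsPath x y p) (hz : z ≠ x) :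
    vert F G z * (pathElt F G p * vert F G y) = 0 := by
  rw [← vert_mul_pathElt h, ← mul_assoc, vert_mul_vert_of_ne hz, zero_mul]

theorem ghostElt_mul_vert {x y : V} {p : List E} (h : G.IsPath x y p) :
    vert F G y * ghostElt F G p * vert F G x = vert F G y * ghostElt F G p := by
  cases h with
  | nil => simp [vert_mul_self]
  | cons h => rw [ghostElt_cons, mul_assoc, mul_assoc, ghost_mul_source]

theorem ghostElt_mul_vert_of_ne {x y z : V} {p : List E} (h : G.IsPath x y p) (hz : x ≠ z) :
    vert F G y * ghostElt F G p * vert F G z = 0 := by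
  rw [← ghostElt_mul_vert h, mul_assoc, vert_mul_vert_of_ne hz, mul_zero]

theorem pathElt_mem {x y : V} {p : List E} (h : G.IsPath x y p) :
    pathElt F G p * vert F G y ∈ lpa F G := by
  induction h with
  | nil x => simpa using vert_mem x
  | cons h ih => rw [pathElt_cons, mul_assoc]; exact mul_mem (edge_mem _) ih

theorem ghostElt_mem {x y : V} {p : List E} (h : G.IsPath x y p) :
    vert F G y * ghostElt F G p ∈ lpa F G := by
  induction h with
  | nil x => simpa using vert_mem x
  | cons h ih => rw [ghostElt_cons, ← mul_assoc]; exact mul_mem ih (ghost_mem _)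

theorem ghostElt_mul_pathElt {x y : V} {p : List E} (h : G.IsPath x y p) :
    ghostElt F G p * (pathElt F G p * vert F G y) = vert F G y := by
  induction h with
  | nil x => simp
  | @cons e y p h ih =>
    rw [ghostElt_cons, pathElt_cons, mul_assoc, mul_assoc, ← mul_assoc (ghost F G e),
      ghost_mul_edge_self, vert_mul_pathElt h, ih]

/-- `p* q` vanishes or is a path, if `p` is not longer than `q`. -/
theorem ghostElt_mul_pathElt_cases {x y x' y' : V} {p q : List E} (hp : G.IsPath x y p)
    (hq : G.IsPath x' y' q) (hl : p.length ≤ q.length) :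
    vert F G y * ghostElt F G p * (pathElt F G q * vert F G y') = 0 ∨
      ∃ t, G.IsPath y y' t ∧ q = p ++ t ∧
        vert F G y * ghostElt F G p * (pathElt F G q * vert F G y') =
          pathElt F G t * vert F G y' := by
  induction hp generalizing x' q with
  | nil x =>
    by_cases h : x = x'
    · subst h
      exact .inr ⟨q, hq, rfl, by simp [vert_mul_pathElt hq]⟩
    · exact .inl (by simp [vert_mul_pathElt_of_ne hq h])
  | @cons e y p h ih =>
    cases hq with
    | nil => simp at hl
    | @cons f _ q hq =>
      by_cases hef : e = f
      · subst hef
        have key : vert F G y * ghostElt F G (e :: p) * (pathElt F G (e :: q) * vert F G y') =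
            vert F G y * ghostElt F G p * (pathElt F G q * vert F G y') := by
          rw [ghostElt_cons, pathElt_cons, mul_assoc (edge F G e), mul_assoc, mul_assoc,
            ← mul_assoc (ghost F G e), ghost_mul_edge_self, vert_mul_pathElt hq, mul_assoc]
        rw [key]
        rcases ih hq (by simpa using hl) with h0 | ⟨t, ht, rfl, h1⟩
        · exact .inl h0
        · exact .inr ⟨t, ht, rfl, h1⟩
      · left
        rw [ghostElt_cons, pathElt_cons, mul_assoc (edge F G f), mul_assoc, mul_assoc,
          ← mul_assoc (ghost F G e), ghost_mul_edge_of_ne hef]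
        simp

/-- The common prefix `α` cancels and leaves `f* e = 0`. This is how an exit is used throughout. -/
theorem ghostElt_mul_pathElt_of_diverge {x : V} {e f : E} {α : List E} (β γ : List E)
    (h : G.IsPath x (G.s e) α) (hef : f ≠ e) :
    ghostElt F G (α ++ f :: β) * pathElt F G (α ++ e :: γ) = 0 := by
  have h1 : ghostElt F G α * (pathElt F G α * edge F G e) = edge F G e := by
    rw [← source_mul_edge e, ← mul_assoc (pathElt F G α), ← mul_assoc,
      ghostElt_mul_pathElt h]
  calc _ = ghostElt F G β * (ghost F G f * (ghostElt F G α * (pathElt F G α * edge F G e))) *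
        pathElt F G γ := by
        simp only [ghostElt_append, pathElt_append, ghostElt_cons, pathElt_cons, mul_assoc]
    _ = 0 := by rw [h1, ghost_mul_edge_of_ne hef]; simp

/-- The monomials `p q*` of degree `n` with edges in `A` and range in `W`. -/
def monomials (F : Type w) [Field F] (G : DirGraph V E) (A : Set E) (W : Set V) (n : ℤ) :
    Set (LeavittUnitization F G) :=
  {a | ∃ (p q : List E) (x y z : V), G.IsPath x z p ∧ G.IsPath y z q ∧ (∀ e ∈ p, e ∈ A) ∧
    (∀ e ∈ q, e ∈ A) ∧ z ∈ W ∧ (p.length : ℤ) - q.length = n ∧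
    a = pathElt F G p * (vert F G z * ghostElt F G q)}

/-- The generators with edges in `A` and vertices in `W`. -/
def _root_.DirGraph.LGen.Supported (A : Set E) (W : Set V) : LGen V E → Prop
  | .vert x => x ∈ W
  | .edge e => e ∈ A
  | .ghost e => e ∈ A

theorem gen_mem_monomials {A : Set E} {W : Set V} (hr : ∀ e ∈ A, G.r e ∈ W) {g : LGen V E}
    (hg : g.Supported A W) : gen F G g ∈ monomials F G A W g.deg := by
  rcases g with x | e | e
  · exact ⟨[], [], x, x, x, .nil _, .nil _, by simp, by simp, hg, by simp [LGen.deg],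
      by simp [vert]⟩
  · exact ⟨[e], [], _, _, _, .single e, .nil _, by simpa [LGen.Supported] using hg, by simp, hr e hg,
      by simp [LGen.deg], by simp [pathElt_cons, edge_mul_range]; rfl⟩
  · exact ⟨[], [e], _, _, _, .nil _, .single e, by simp, by simpa [LGen.Supported] using hg, hr e hg,
      by simp [LGen.deg], by simp [ghostElt_cons, range_mul_ghost]; rfl⟩

/-- A generator on the left only touches the first edge of `p`, so the product of two general
monomials never has to be computed. Tracking `A` and `W` serves the finite-dimensionality argument
for acyclic graphs. -/
theorem gen_mul_monomials {A : Set E} {W : Set V} (hr : ∀ e ∈ A, G.r e ∈ W) {g : LGen V E}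
    (hg : g.Supported A W) {n : ℤ} {a : LeavittUnitization F G} (ha : a ∈ monomials F G A W n) :
    gen F G g * a = 0 ∨ gen F G g * a ∈ monomials F G A W (g.deg + n) := by
  obtain ⟨p, q, x, y, z, hp, hq, hpA, hqA, hz, hn, rfl⟩ := ha
  rcases g with t | e | e
  · change vert F G t * _ = 0 ∨ vert F G t * _ ∈ _
    by_cases htx : t = x
    · subst htx
      right
      refine ⟨p, q, t, y, z, hp, hq, hpA, hqA, hz, by simp [LGen.deg, hn], ?_⟩
      rw [← mul_assoc (pathElt F G p), ← mul_assoc, vert_mul_pathElt hp]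
    · left
      rw [← mul_assoc (pathElt F G p), ← mul_assoc, vert_mul_pathElt_of_ne hp htx, zero_mul]
  · change edge F G e * _ = 0 ∨ edge F G e * _ ∈ _
    by_cases htx : G.r e = x
    · subst htx
      right
      refine ⟨e :: p, q, _, y, z, hp.cons, hq, ?_, hqA, hz, ?_, by
        rw [pathElt_cons, mul_assoc]⟩
      · simpa using ⟨hg, hpA⟩
      · simp [LGen.deg]; omega
    · left
      rw [← mul_assoc (pathElt F G p), ← vert_mul_pathElt hp, mul_assoc, ← mul_assoc,
        edge_mul_vert_of_ne htx, zero_mul]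
  · change ghost F G e * _ = 0 ∨ ghost F G e * _ ∈ _
    cases hp with
    | nil =>
      by_cases hs : G.s e = x
      · subst hs
        right
        refine ⟨[], q ++ [e], _, y, _, .nil _, hq.append (.single e), by simp, ?_, hr e hg, ?_, ?_⟩
        · intro f hf
          rcases List.mem_append.1 hf with hf | hf
          · exact hqA f hf
          · simp at hf; subst hf; exact hg
        · simp [LGen.deg] at hn ⊢; omega
        · simp only [pathElt_nil, one_mul, ghostElt_append, ghostElt_cons, ghostElt_nil]
          rw [← mul_assoc, ghost_mul_source, ← mul_assoc, range_mul_ghost]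
      · left
        simp only [pathElt_nil, one_mul]
        rw [← mul_assoc, ghost_mul_vert_of_ne hs, zero_mul]
    | @cons f _ p hp =>
      by_cases hef : e = f
      · subst hef
        right
        refine ⟨p, q, _, y, z, hp, hq, fun f hf => hpA f (by simp [hf]), hqA, hz, ?_, ?_⟩
        · simp [LGen.deg] at hn ⊢; omega
        · rw [pathElt_cons, mul_assoc, ← mul_assoc, ghost_mul_edge_self,
            ← mul_assoc (pathElt F G p), ← mul_assoc, vert_mul_pathElt hp]
      · left
        rw [pathElt_cons, mul_assoc, ← mul_assoc, ghost_mul_edge_of_ne hef, zero_mul]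

theorem adjoin_le_span_monomials {A : Set E} {W : Set V} (hr : ∀ e ∈ A, G.r e ∈ W)
    {a : LeavittUnitization F G}
    (ha : a ∈ NonUnitalAlgebra.adjoin F (gen F G '' {g | g.Supported A W})) :
    a ∈ Submodule.span F (⋃ n, monomials F G A W n) := by
  set S := Submodule.span F (⋃ n, monomials F G A W n)
  -- The second half makes the induction pass through products.
  suffices h : a ∈ S ∧ ∀ b ∈ S, a * b ∈ S from h.1
  induction ha using NonUnitalAlgebra.adjoin_induction with
  | mem x hx =>
    obtain ⟨g, hg, rfl⟩ := hx
    refine ⟨Submodule.subset_span (Set.mem_iUnion.2 ⟨_, gen_mem_monomials hr hg⟩), fun b hb => ?_⟩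
    induction hb using Submodule.span_induction with
    | mem b hb =>
      obtain ⟨n, hb⟩ := Set.mem_iUnion.1 hb
      rcases gen_mul_monomials hr hg hb with h | h
      · rw [h]; exact zero_mem _
      · exact Submodule.subset_span (Set.mem_iUnion.2 ⟨_, h⟩)
    | zero => simp
    | add x y _ _ hx hy => rw [mul_add]; exact add_mem hx hy
    | smul c x _ hx => rw [mul_smul_comm]; exact S.smul_mem c hx
  | zero => simp
  | add x y _ _ hx hy =>
    exact ⟨add_mem hx.1 hy.1, fun b hb => by rw [add_mul]; exact add_mem (hx.2 b hb) (hy.2 b hb)⟩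
  | mul x y _ _ hx hy =>
    exact ⟨hx.2 y hy.1, fun b hb => by rw [mul_assoc]; exact hx.2 _ (hy.2 b hb)⟩
  | smul c x _ hx =>
    exact ⟨S.smul_mem c hx.1, fun b hb => by rw [smul_mul_assoc]; exact S.smul_mem c (hx.2 b hb)⟩

theorem mem_span_of_isMonomial {a : LeavittPathAlgebra F G} {n : ℤ}
    (ha : LeavittPathAlgebra.IsMonomial F G a n) :
    (a : LeavittUnitization F G) ∈ Submodule.span F (monomials F G Set.univ Set.univ n) := by
  suffices h : (a : LeavittUnitization F G) ∈ Submodule.span F (monomials F G .univ .univ n) ∧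
      ∀ m, ∀ b ∈ Submodule.span F (monomials F G .univ .univ m),
        (a : LeavittUnitization F G) * b ∈
          Submodule.span F (monomials F G .univ .univ (n + m)) from h.1
  induction ha with
  | gen g =>
    have hg : g.Supported (Set.univ : Set E) (Set.univ : Set V) := by
      rcases g with _ | _ | _ <;> trivial
    refine ⟨Submodule.subset_span (gen_mem_monomials (by simp) hg), fun m b hb => ?_⟩
    change gen F G g * b ∈ _
    induction hb using Submodule.span_induction with
    | mem b hb =>
      rcases gen_mul_monomials (by simp) hg hb with h | h
      · rw [h]; exact zero_mem _
      · exact Submodule.subset_span h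
    | zero => simp
    | add x y _ _ hx hy => rw [mul_add]; exact add_mem hx hy
    | smul c x _ hx => rw [mul_smul_comm]; exact Submodule.smul_mem _ c hx
  | @mul a b m n _ _ iha ihb =>
    refine ⟨iha.2 _ _ ihb.1, fun k c hc => ?_⟩
    rw [NonUnitalSubalgebra.coe_mul, mul_assoc, add_assoc]
    exact iha.2 _ _ (ihb.2 k c hc)

/-! ### Reduction of an element to a vertex -/

/-- The monomials `p q*` with degree in `T` and `q` of length at most `N`. -/
def boundedMonomials (F : Type w) [Field F] (G : DirGraph V E) (T : Set ℤ) (N : ℕ) :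
    Set (LeavittUnitization F G) :=
  {a | ∃ (p q : List E) (x y z : V), G.IsPath x z p ∧ G.IsPath y z q ∧
    (p.length : ℤ) - q.length ∈ T ∧ q.length ≤ N ∧
    a = pathElt F G p * (vert F G z * ghostElt F G q)}

/-- The paths ending at `z` with length in `T`. -/
def pathsTo (F : Type w) [Field F] (G : DirGraph V E) (T : Set ℤ) (z : V) :
    Set (LeavittUnitization F G) :=
  {a | ∃ (p : List E) (x : V), G.IsPath x z p ∧ (p.length : ℤ) ∈ T ∧
    a = pathElt F G p * vert F G z}

/-- Finite sums of vertices are local units: the vertices at which the ghost parts of `a` start sum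
to a right identity for `a`. -/
theorem exists_mul_vert_ne_zero {T : Set ℤ} {N : ℕ} {a : LeavittUnitization F G}
    (ha : a ∈ Submodule.span F (boundedMonomials F G T N)) (h0 : a ≠ 0) :
    ∃ x, a * vert F G x ≠ 0 := by
  classical
  suffices h : ∃ s : Finset V, ∀ s', s ⊆ s' → a * ∑ x ∈ s', vert F G x = a by
    obtain ⟨s, hs⟩ := h
    by_contra! hc
    apply h0
    rw [← hs s subset_rfl, Finset.mul_sum]
    exact Finset.sum_eq_zero fun x _ => hc x
  induction ha using Submodule.span_induction with
  | mem a ha =>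
    obtain ⟨p, q, x, y, z, hp, hq, -, -, rfl⟩ := ha
    refine ⟨{y}, fun s hs => ?_⟩
    rw [Finset.singleton_subset_iff] at hs
    rw [Finset.mul_sum, Finset.sum_eq_single_of_mem y hs, mul_assoc, ghostElt_mul_vert hq]
    intro b _ hb
    rw [mul_assoc, ghostElt_mul_vert_of_ne hq hb.symm, mul_zero]
  | zero => exact ⟨∅, by simp⟩
  | add a b _ _ iha ihb =>
    by_cases ha : a = 0
    · by_cases hb : b = 0
      · exact ⟨∅, by simp [ha, hb]⟩
      · obtain ⟨s, hs⟩ := ihb hb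
        exact ⟨s, fun s' h => by rw [ha, zero_add, hs s' h]⟩
    · obtain ⟨s, hs⟩ := iha ha
      by_cases hb : b = 0
      · exact ⟨s, fun s' h => by rw [hb, add_zero, hs s' h]⟩
      · obtain ⟨t, ht⟩ := ihb hb
        exact ⟨s ∪ t, fun s' h => by
          rw [add_mul, hs s' (Finset.union_subset_left h), ht s' (Finset.union_subset_right h)]⟩
  | smul c a _ iha =>
    by_cases ha : a = 0
    · exact ⟨∅, by simp [ha]⟩
    · obtain ⟨s, hs⟩ := iha ha
      exact ⟨s, fun s' h => by rw [smul_mul_assoc, hs s' h]⟩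

/-- Only monomials `p q*` with `q` starting at `x` survive, and either alternative in `hx` forces
such a `q` to be empty. -/
theorem mul_vert_mem_span_pathsTo {T : Set ℤ} {N : ℕ} {a : LeavittUnitization F G} {x : V}
    (hx : N = 0 ∨ ∀ e, G.s e ≠ x) (ha : a ∈ Submodule.span F (boundedMonomials F G T N)) :
    a * vert F G x ∈ Submodule.span F (pathsTo F G T x) := by
  induction ha using Submodule.span_induction with
  | mem a ha =>
    obtain ⟨p, q, x', y, z, hp, hq, hT, hN, rfl⟩ := ha
    by_cases hxy : y = x
    · subst hxy
      have hq0 : q = [] := by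
        rcases hx with rfl | hx
        · simpa using hN
        · cases hq with
          | nil => rfl
          | cons => exact absurd rfl (hx _)
      subst hq0
      rw [IsPath.nil_iff] at hq
      subst hq
      refine Submodule.subset_span ⟨p, x', hp, by simpa using hT, ?_⟩
      simp [mul_assoc, vert_mul_self]
    · rw [mul_assoc, ghostElt_mul_vert_of_ne hq hxy, mul_zero]
      exact zero_mem _
  | zero => simp
  | add a b _ _ iha ihb => rw [add_mul]; exact add_mem iha ihb
  | smul c a _ iha => rw [smul_mul_assoc]; exact Submodule.smul_mem _ c iha

/-- The edge cancels the first edge of `q`, or is appended to `p` if `q` is empty. In both cases the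
degree rises by one and the bound on `q` drops. -/
theorem mul_edge_mem_span {T : Set ℤ} {N : ℕ} {a : LeavittUnitization F G} (e : E)
    (ha : a ∈ Submodule.span F (boundedMonomials F G T (N + 1))) :
    a * edge F G e ∈ Submodule.span F (boundedMonomials F G {i | i - 1 ∈ T} N) := by
  induction ha using Submodule.span_induction with
  | mem a ha =>
    obtain ⟨p, q, x', y, z, hp, hq, hT, hN, rfl⟩ := ha
    cases hq with
    | nil =>
      by_cases h : y = G.s e
      · subst h
        refine Submodule.subset_span
          ⟨p ++ [e], [], x', _, G.r e, hp.append (.single e), .nil _, ?_, by simp, ?_⟩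
        · simpa using hT
        · simp [pathElt_append, pathElt_cons, mul_assoc, source_mul_edge, edge_mul_range]
      · simp [mul_assoc, vert_mul_edge_of_ne h]
    | @cons f _ q hq =>
      by_cases h : f = e
      · subst h
        refine Submodule.subset_span ⟨p, q, x', _, z, hp, hq, ?_, by simpa using hN, ?_⟩
        · simp only [List.length_cons, Nat.cast_add, Nat.cast_one] at hT
          simp only [Set.mem_ofPred_eq]
          convert hT using 1
          ring
        · rw [ghostElt_cons, mul_assoc, ← mul_assoc (vert F G z), mul_assoc _ (ghost F G f),
            ghost_mul_edge_self, ghostElt_mul_vert hq]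
      · rw [ghostElt_cons, mul_assoc, mul_assoc, mul_assoc, ghost_mul_edge_of_ne h]
        simp
  | zero => simp
  | add a b _ _ iha ihb => rw [add_mul]; exact add_mem iha ihb
  | smul c a _ iha => rw [smul_mul_assoc]; exact Submodule.smul_mem _ c iha

/-- Ghost edges are removed one at a time: if `a x ≠ 0` and `x` is not a sink, then `x = ∑ e e*`
shows `a e ≠ 0` for some `e`. The integer `k` is the total change of degree. -/
theorem exists_mul_mem_span_pathsTo (hG : G.RowFinite) {T : Set ℤ} {N : ℕ}
    {a : LeavittUnitization F G} (ha : a ∈ Submodule.span F (boundedMonomials F G T N))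
    (h0 : a ≠ 0) : ∃ b ∈ lpa F G, ∃ (z : V) (k : ℤ), a * b ≠ 0 ∧
      a * b ∈ Submodule.span F (pathsTo F G {i | i - k ∈ T} z) := by
  induction N generalizing T a with
  | zero =>
    obtain ⟨x, hx⟩ := exists_mul_vert_ne_zero ha h0
    exact ⟨_, vert_mem x, x, 0, hx, by simpa using mul_vert_mem_span_pathsTo (.inl rfl) ha⟩
  | succ N ih =>
    obtain ⟨x, hx⟩ := exists_mul_vert_ne_zero ha h0
    by_cases hs : ∀ e, G.s e ≠ x
    · exact ⟨_, vert_mem x, x, 0, hx, by simpa using mul_vert_mem_span_pathsTo (.inr hs) ha⟩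
    · push Not at hs
      obtain ⟨e, he⟩ : ∃ e, a * edge F G e ≠ 0 := by
        by_contra! hc
        apply hx
        rw [vert_eq_sum x (hG x) hs, Finset.mul_sum]
        exact Finset.sum_eq_zero fun e _ => by rw [← mul_assoc, hc, zero_mul]
      obtain ⟨b, hb, z, k, h1, h2⟩ := ih (mul_edge_mem_span e ha) he
      refine ⟨edge F G e * b, mul_mem (edge_mem e) hb, z, k + 1, by rwa [← mul_assoc], ?_⟩
      rw [← mul_assoc]
      convert h2 using 5
      simp [sub_sub]

/-- The closed paths of positive length at `z` with length in `T - T`. -/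
def closedPaths (F : Type w) [Field F] (G : DirGraph V E) (T : Set ℤ) (z : V) :
    Set (LeavittUnitization F G) :=
  {a | ∃ p : List E, G.IsPath z z p ∧ p ≠ [] ∧ (∃ i ∈ T, ∃ j ∈ T, (p.length : ℤ) = i - j) ∧
    a = pathElt F G p * vert F G z}

/-- Multiply by `p*` for a shortest path `p` in the support. Then `p* p = z`, while any other `p* q`
is zero or the remainder of `q` after `p`, a nonempty closed path at `z`. Its length is a difference
of two lengths in `T`, so nothing remains in the homogeneous case. -/
theorem exists_mul_eq_smul_vert_add {T : Set ℤ} {z : V} {a : LeavittUnitization F G}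
    (ha : a ∈ Submodule.span F (pathsTo F G T z)) (h0 : a ≠ 0) :
    ∃ b ∈ lpa F G, ∃ c : F, c ≠ 0 ∧ ∃ d ∈ Submodule.span F (closedPaths F G T z),
      b * a = c • vert F G z + d := by
  classical
  let ι := {p : List E // (∃ x, G.IsPath x z p) ∧ (p.length : ℤ) ∈ T}
  have hrange : pathsTo F G T z = Set.range fun p : ι => pathElt F G p.1 * vert F G z := by
    ext a
    constructor
    · rintro ⟨p, x, hp, hT, rfl⟩
      exact ⟨⟨p, ⟨x, hp⟩, hT⟩, rfl⟩
    · rintro ⟨⟨p, ⟨x, hp⟩, hT⟩, rfl⟩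
      exact ⟨p, x, hp, hT, rfl⟩
  rw [hrange, Finsupp.mem_span_range_iff_exists_finsupp] at ha
  obtain ⟨c, rfl⟩ := ha
  have hne : c.support.Nonempty := by
    rw [Finsupp.support_nonempty_iff]
    rintro rfl
    simp at h0
  obtain ⟨p, hp, hmin⟩ := c.support.exists_min_image (fun p => p.1.length) hne
  obtain ⟨⟨p, ⟨x, hpx⟩, hpT⟩, rfl⟩ : ∃ q : ι, q = p := ⟨p, rfl⟩
  refine ⟨_, ghostElt_mem hpx, c _, Finsupp.mem_support_iff.1 hp, ?_⟩
  refine ⟨vert F G z * ghostElt F G p * ∑ q ∈ c.support.erase ⟨p, ⟨x, hpx⟩, hpT⟩,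
    c q • (pathElt F G q.1 * vert F G z), ?_, ?_⟩
  rotate_left
  · rw [Finsupp.sum, ← Finset.add_sum_erase _ _ hp, mul_add, mul_smul_comm, mul_assoc,
      ghostElt_mul_pathElt hpx, vert_mul_self]
  · rw [Finset.mul_sum]
    refine sum_mem fun q hq => ?_
    obtain ⟨hqp, hq⟩ := Finset.mem_erase.1 hq
    rw [mul_smul_comm]
    refine Submodule.smul_mem _ _ ?_
    obtain ⟨q, ⟨y, hqy⟩, hqT⟩ := q
    rcases ghostElt_mul_pathElt_cases (F := F) hpx hqy (hmin _ hq) with h | ⟨t, ht, rfl, h⟩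
    · rw [h]; exact zero_mem _
    · rw [h]
      refine Submodule.subset_span ⟨t, ht, ?_, ⟨_, hqT, _, hpT, by simp⟩, rfl⟩
      rintro rfl
      exact hqp (by simp)

/-- The linear combinations of at most `k` closed paths of positive length at `z`. -/
inductive ClosedCombination (F : Type w) [Field F] (G : DirGraph V E) (z : V) :
    ℕ → LeavittUnitization F G → Prop
  | zero : ClosedCombination F G z 0 0
  | skip {k : ℕ} {a : LeavittUnitization F G} :
      ClosedCombination F G z k a → ClosedCombination F G z (k + 1) a
  | add {k : ℕ} {a : LeavittUnitization F G} (c : F) {p : List E} :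
      G.IsPath z z p → p ≠ [] → ClosedCombination F G z k a →
      ClosedCombination F G z (k + 1) (c • (pathElt F G p * vert F G z) + a)

namespace ClosedCombination

theorem sum {z : V} {k l : ℕ} {a b : LeavittUnitization F G} (ha : ClosedCombination F G z k a)
    (hb : ClosedCombination F G z l b) : ClosedCombination F G z (k + l) (a + b) := by
  induction ha with
  | zero => simpa using hb
  | @skip k _ _ ih => rw [add_right_comm]; exact ih.skip
  | @add k _ c p hp hne _ ih => 
    rw [add_right_comm, add_assoc (c • _)]
    exact .add c hp hne ih

theorem smul {z : V} {k : ℕ} {a : LeavittUnitization F G} (ha : ClosedCombination F G z k a)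
    (c : F) : ClosedCombination F G z k (c • a) := by
  induction ha with
  | zero => simpa using .zero
  | skip _ ih => exact ih.skip
  | add d hp hne _ ih => rw [smul_add, smul_smul]; exact .add _ hp hne ih

theorem of_mem_span {T : Set ℤ} {z : V} {a : LeavittUnitization F G}
    (ha : a ∈ Submodule.span F (closedPaths F G T z)) : ∃ k, ClosedCombination F G z k a := by
  induction ha using Submodule.span_induction with
  | mem a ha =>
    obtain ⟨p, hp, hne, -, rfl⟩ := ha
    exact ⟨1, by simpa using (ClosedCombination.zero (F := F)).add 1 hp hne⟩
  | zero => exact ⟨0, .zero⟩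
  | add a b _ _ iha ihb =>
    obtain ⟨k, hk⟩ := iha
    obtain ⟨l, hl⟩ := ihb
    exact ⟨_, hk.sum hl⟩
  | smul c a _ iha =>
    obtain ⟨k, hk⟩ := iha
    exact ⟨k, hk.smul c⟩

/-- A term `γ* p γ` is zero or a closed path `t` with `p γ = γ t`, so `t` is as long as `p` and
nonempty. The bound `k` does not grow. -/
theorem conj {z y : V} {k : ℕ} {a : LeavittUnitization F G} (ha : ClosedCombination F G z k a)
    {γ : List E} (hγ : G.IsPath z y γ) :
    ClosedCombination F G y k
      (vert F G y * ghostElt F G γ * a * (pathElt F G γ * vert F G y)) := by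
  induction ha with
  | zero => simpa using .zero
  | skip _ ih => exact ih.skip
  | @add k a c p hp hne _ ih =>
    have hpγ : vert F G y * ghostElt F G γ * (pathElt F G p * vert F G z) *
        (pathElt F G γ * vert F G y) =
        vert F G y * ghostElt F G γ * (pathElt F G (p ++ γ) * vert F G y) := by
      rw [mul_assoc, mul_assoc (pathElt F G p), vert_mul_pathElt hγ, pathElt_append, mul_assoc,
        mul_assoc, mul_assoc]
    rw [mul_add, add_mul, mul_smul_comm, smul_mul_assoc, hpγ]
    rcases ghostElt_mul_pathElt_cases (F := F) hγ (hp.append hγ) (by simp) with h | ⟨t, ht, h1, h⟩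
    · rw [h, smul_zero, zero_add]
      exact ih.skip
    · rw [h]
      refine .add c ht ?_ ih
      rintro rfl
      have := congrArg List.length h1
      simp [hne] at this

end ClosedCombination

/-- Induction on the number of closed paths. If `p = α e β` and `f ≠ e` is an exit at `e`, then
conjugation by `α f` kills `p`, turns the vertex `z` into the vertex `r f`, and keeps the other
terms closed paths by `conj`. -/
theorem exists_mul_mul_eq_vert_of_closedCombination (hL : G.ClosedPathsHaveExits) {k : ℕ} {z : V}
    {c : F} (hc : c ≠ 0) {a : LeavittUnitization F G} (ha : ClosedCombination F G z k a) :
    ∃ b ∈ lpa F G, ∃ d ∈ lpa F G, ∃ x, b * (c • vert F G z + a) * d = vert F G x := by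
  induction k generalizing z a with
  | zero =>
    cases ha
    refine ⟨c⁻¹ • vert F G z, Submodule.smul_mem (lpa F G).toSubmodule _ (vert_mem z), _, vert_mem z, z, ?_⟩
    simp [smul_smul, hc, vert_mul_self]
  | succ k ih =>
    cases ha with
    | skip ha => exact ih ha
    | @add _ a c' p hp hne ha =>
      obtain ⟨e, he, f, hfe, hs⟩ := hL z p hp hne
      obtain ⟨α, β, rfl⟩ := List.append_of_mem he
      obtain ⟨y, hα, hβ⟩ := IsPath.append_iff.1 hp
      obtain ⟨rfl, hβ⟩ := IsPath.cons_iff.1 hβ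
      have hγ : G.IsPath z (G.r f) (α ++ [f]) := hα.append (by rw [← hs]; exact .single f)
      obtain ⟨b, hb, d, hd, x, h⟩ := ih (ha.conj hγ)
      refine ⟨b * (vert F G (G.r f) * ghostElt F G (α ++ [f])),
        mul_mem hb (ghostElt_mem hγ), (pathElt F G (α ++ [f]) * vert F G (G.r f)) * d,
        mul_mem (pathElt_mem hγ) hd, x, ?_⟩
      rw [← h]
      have h1 : vert F G (G.r f) * ghostElt F G (α ++ [f]) * (c • vert F G z) *
          (pathElt F G (α ++ [f]) * vert F G (G.r f)) = c • vert F G (G.r f) := by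
        rw [mul_smul_comm, smul_mul_assoc, mul_assoc, vert_mul_pathElt hγ, mul_assoc,
          ghostElt_mul_pathElt hγ, vert_mul_self]
      have h2 : vert F G (G.r f) * ghostElt F G (α ++ [f]) *
          (c' • (pathElt F G (α ++ e :: β) * vert F G z)) = 0 := by
        rw [mul_smul_comm, mul_assoc, ← mul_assoc (ghostElt F G _),
          ghostElt_mul_pathElt_of_diverge [] β hα hfe]
        simp
      calc _ = b * (vert F G (G.r f) * ghostElt F G (α ++ [f]) *
              (c • vert F G z + (c' • (pathElt F G (α ++ e :: β) * vert F G z) + a)) *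
              (pathElt F G (α ++ [f]) * vert F G (G.r f))) * d := by simp only [mul_assoc]
        _ = _ := by
          rw [mul_add, mul_add, h2, zero_add, add_mul, h1]

theorem exists_mul_mul_eq_smul_vert_add (hG : G.RowFinite) {T : Set ℤ}
    {a : LeavittUnitization F G}
    (ha : a ∈ Submodule.span F (⋃ n ∈ T, monomials F G Set.univ Set.univ n)) (h0 : a ≠ 0) :
    ∃ b ∈ lpa F G, ∃ d ∈ lpa F G, ∃ z, ∃ c : F, c ≠ 0 ∧
      ∃ t ∈ Submodule.span F (closedPaths F G T z), b * a * d = c • vert F G z + t := by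
  obtain ⟨N, hN⟩ : ∃ N, a ∈ Submodule.span F (boundedMonomials F G T N) := by
    have hmono : ∀ M N, M ≤ N → Submodule.span F (boundedMonomials F G T M) ≤
        Submodule.span F (boundedMonomials F G T N) := fun M N h => Submodule.span_mono <| by
      rintro _ ⟨p, q, x, y, z, hp, hq, h1, h2, rfl⟩
      exact ⟨p, q, x, y, z, hp, hq, h1, h2.trans h, rfl⟩
    clear h0
    induction ha using Submodule.span_induction with
    | mem a ha =>
      simp only [Set.mem_iUnion] at ha
      obtain ⟨n, hn, p, q, x, y, z, hp, hq, -, -, -, rfl, rfl⟩ := ha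
      exact ⟨q.length, Submodule.subset_span ⟨p, q, x, y, z, hp, hq, hn, le_rfl, rfl⟩⟩
    | zero => exact ⟨0, zero_mem _⟩
    | add a b _ _ iha ihb =>
      obtain ⟨M, hM⟩ := iha
      obtain ⟨N, hN⟩ := ihb
      exact ⟨max M N, add_mem (hmono _ _ (le_max_left _ _) hM) (hmono _ _ (le_max_right _ _) hN)⟩
    | smul c a _ iha =>
      obtain ⟨M, hM⟩ := iha
      exact ⟨M, Submodule.smul_mem _ c hM⟩
  obtain ⟨d, hd, z, k, h1, h2⟩ := exists_mul_mem_span_pathsTo hG hN h0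
  obtain ⟨b, hb, c, hc, t, ht, h3⟩ := exists_mul_eq_smul_vert_add h2 h1
  refine ⟨b, hb, d, hd, z, c, hc, t, ?_, by rw [mul_assoc, h3]⟩
  -- The shift of `T` by `k` cancels in differences of lengths.
  refine Submodule.span_mono ?_ ht
  rintro _ ⟨p, hp, hne, ⟨i, hi, j, hj, hij⟩, rfl⟩
  exact ⟨p, hp, hne, ⟨_, hi, _, hj, by rw [hij]; ring⟩, rfl⟩

end LeavittUnitization

/-! ### Two-sided multiples equal to a vertex -/

namespace LeavittPathAlgebra

open LeavittUnitization

theorem exists_mul_mul_eq_vert (hG : G.RowFinite) (hL : G.ClosedPathsHaveExits)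
    {a : LeavittPathAlgebra F G} (h0 : a ≠ 0) :
    ∃ b d x, b * a * d = gen F G (.vert x) := by
  have h0' : (a : LeavittUnitization F G) ≠ 0 := fun h => h0 (Subtype.ext h)
  have ha : (a : LeavittUnitization F G) ∈
      Submodule.span F (⋃ n ∈ (Set.univ : Set ℤ), monomials F G Set.univ Set.univ n) := by
    have := adjoin_le_span_monomials (F := F) (G := G) (A := .univ) (W := .univ) (by simp)
      (a := a) (by
        convert a.2 using 2
        ext x
        constructor
        · rintro ⟨g, -, rfl⟩; exact ⟨g, rfl⟩
        · rintro ⟨g, rfl⟩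
          exact ⟨g, by rcases g with _ | _ | _ <;> trivial, rfl⟩)
    simpa using this
  obtain ⟨b, hb, d, hd, z, c, hc, t, ht, h⟩ := exists_mul_mul_eq_smul_vert_add hG ha h0'
  obtain ⟨k, hk⟩ := ClosedCombination.of_mem_span ht
  obtain ⟨b', hb', d', hd', x, h'⟩ := exists_mul_mul_eq_vert_of_closedCombination hL hc hk
  refine ⟨⟨b' * b, mul_mem hb' hb⟩, ⟨d * d', mul_mem hd hd'⟩, x, Subtype.ext ?_⟩
  change b' * b * (a : LeavittUnitization F G) * (d * d') = vert F G x
  rw [← h', ← h]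
  simp only [mul_assoc]

theorem exists_mul_mul_eq_vert_of_mem_component (hG : G.RowFinite) {n : ℤ}
    {a : LeavittPathAlgebra F G} (ha : a ∈ component F G n) (h0 : a ≠ 0) :
    ∃ b d x, b * a * d = gen F G (.vert x) := by
  have h0' : (a : LeavittUnitization F G) ≠ 0 := fun h => h0 (Subtype.ext h)
  have ha' : (a : LeavittUnitization F G) ∈
      Submodule.span F (⋃ m ∈ ({n} : Set ℤ), monomials F G Set.univ Set.univ m) := by
    rw [Set.biUnion_singleton]
    clear h0 h0'
    induction ha using Submodule.span_induction with
    | mem a ha => exact mem_span_of_isMonomial ha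
    | zero => exact zero_mem (Submodule.span F (monomials F G Set.univ Set.univ n))
    | add a b _ _ iha ihb =>
      have h : ((a + b : LeavittPathAlgebra F G) : LeavittUnitization F G) = a + b := rfl
      rw [h]
      exact add_mem iha ihb
    | smul c a _ iha =>
      have h : ((c • a : LeavittPathAlgebra F G) : LeavittUnitization F G) = c • a.1 := rfl
      rw [h]
      exact Submodule.smul_mem _ c iha
  obtain ⟨b, hb, d, hd, z, c, hc, t, ht, h⟩ := exists_mul_mul_eq_smul_vert_add hG ha' h0'
  -- With a single degree `n` a closed path in the remainder would have length `n - n = 0`.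
  have ht0 : t = 0 := by
    have : closedPaths F G {n} z = ∅ := by
      ext t
      simp only [Set.mem_empty_iff_false, iff_false]
      rintro ⟨p, -, hne, ⟨i, rfl, j, rfl, hij⟩, -⟩
      simp [hne] at hij
    simpa [this] using ht
  refine ⟨⟨b, hb⟩, ⟨c⁻¹ • d, Submodule.smul_mem (lpa F G).toSubmodule _ hd⟩, z, Subtype.ext ?_⟩
  change b * (a : LeavittUnitization F G) * (c⁻¹ • d) = vert F G z
  rw [mul_smul_comm, h, ht0, add_zero, smul_smul, inv_mul_cancel₀ hc, one_smul]

end LeavittPathAlgebra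

end DirGraph

namespace DirGraph

variable {V : Type u} {E : Type v} {F : Type w} [Field F] {G : DirGraph V E}

/-! ### Representations from branching systems -/

/-- A branching system: a set of points lying over vertices, together with a way of prolonging a
point over `r e` to the left by the edge `e`, such that every point over a vertex that is not a
sink is obtained in exactly one way. -/
structure BranchingSystem (G : DirGraph V E) (Y : Type*) where
  pos : Y → V
  cons : E → Y → Y
  pos_cons : ∀ e y, pos y = G.r e → pos (cons e y) = G.s e
  cons_inj : ∀ e y e' y', pos y = G.r e → pos y' = G.r e' → cons e y = cons e' y' →
    e = e' ∧ y = y'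
  exists_cons : ∀ y, (∃ e, G.s e = pos y) → ∃ e y', pos y' = G.r e ∧ cons e y' = y

namespace BranchingSystem

variable {Y : Type*} (B : BranchingSystem G Y)

variable (F) in
open Classical in
/-- The action of the generators on the free vector space on the points. -/
noncomputable def genMap : LGen V E → Module.End F (Y →₀ F)
  | .vert x => Finsupp.linearCombination F
      fun y => if B.pos y = x then Finsupp.single y 1 else 0
  | .edge e => Finsupp.linearCombination F
      fun y => if B.pos y = G.r e then Finsupp.single (B.cons e y) 1 else 0
  | .ghost e => Finsupp.linearCombination F
      fun y => if h : ∃ y', B.pos y' = G.r e ∧ B.cons e y' = y then Finsupp.single h.choose 1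
        else 0

theorem genMap_vert_of_eq {x : V} {y : Y} (h : B.pos y = x) :
    B.genMap F (.vert x) (Finsupp.single y 1) = Finsupp.single y 1 := by
  simp [genMap, h]

theorem genMap_vert_of_ne {x : V} {y : Y} (h : B.pos y ≠ x) :
    B.genMap F (.vert x) (Finsupp.single y 1) = 0 := by
  simp [genMap, h]

theorem genMap_edge_of_eq {e : E} {y : Y} (h : B.pos y = G.r e) :
    B.genMap F (.edge e) (Finsupp.single y 1) = Finsupp.single (B.cons e y) 1 := by
  simp [genMap, h]

theorem genMap_edge_of_ne {e : E} {y : Y} (h : B.pos y ≠ G.r e) :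
    B.genMap F (.edge e) (Finsupp.single y 1) = 0 := by
  simp [genMap, h]

theorem genMap_ghost_cons {e : E} {y : Y} (h : B.pos y = G.r e) :
    B.genMap F (.ghost e) (Finsupp.single (B.cons e y) 1) = Finsupp.single y 1 := by
  have hex : ∃ y', B.pos y' = G.r e ∧ B.cons e y' = B.cons e y := ⟨y, h, rfl⟩
  have := (B.cons_inj _ _ _ _ hex.choose_spec.1 h hex.choose_spec.2).2
  simp only [genMap, Finsupp.linearCombination_single, one_smul, dif_pos hex, this]

theorem genMap_ghost_of_not {e : E} {y : Y} (h : ¬∃ y', B.pos y' = G.r e ∧ B.cons e y' = y) :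
    B.genMap F (.ghost e) (Finsupp.single y 1) = 0 := by
  simp only [genMap, Finsupp.linearCombination_single, one_smul, dif_neg h]

/-- All relations are checked on basis points. At a regular vertex `x`, each point over `x` is
prolonged by exactly one edge, so exactly one summand `e e*` fixes it and the others kill it. -/
theorem genMap_rel {a b : FreeAlgebra F (LGen V E)} (h : LeavittRel F G a b) :
    FreeAlgebra.lift F (B.genMap F) a = FreeAlgebra.lift F (B.genMap F) b := by
  refine Finsupp.lhom_ext' fun y => LinearMap.ext_ring ?_
  simp only [LinearMap.comp_apply, Finsupp.lsingle_apply]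
  cases h with
  | vert_mul_vert x x' =>
    by_cases hx' : B.pos y = x'
    · by_cases hx : x = x'
      · subst hx; simp [genMap_vert_of_eq _ hx']
      · simp [hx, genMap_vert_of_eq _ hx', genMap_vert_of_ne B (fun h => hx (h.symm.trans hx'))]
    · by_cases hx : x = x'
      · subst hx; simp [genMap_vert_of_ne _ hx']
      · simp [hx, genMap_vert_of_ne _ hx']
  | source_mul_edge e =>
    by_cases h : B.pos y = G.r e
    · simp [genMap_edge_of_eq _ h, genMap_vert_of_eq _ (B.pos_cons _ _ h)]
    · simp [genMap_edge_of_ne _ h]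
  | edge_mul_range e =>
    by_cases h : B.pos y = G.r e
    · simp [genMap_vert_of_eq _ h]
    · simp [genMap_edge_of_ne _ h, genMap_vert_of_ne _ h]
  | range_mul_ghost e =>
    by_cases h : ∃ y', B.pos y' = G.r e ∧ B.cons e y' = y
    · obtain ⟨y', h, rfl⟩ := h
      simp [genMap_ghost_cons _ h, genMap_vert_of_eq _ h]
    · simp [genMap_ghost_of_not _ h]
  | ghost_mul_source e =>
    by_cases h : B.pos y = G.s e
    · simp [genMap_vert_of_eq _ h]
    · have h' : ¬∃ y', B.pos y' = G.r e ∧ B.cons e y' = y := by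
        rintro ⟨y', h', rfl⟩
        exact h (B.pos_cons _ _ h')
      simp [genMap_ghost_of_not _ h', genMap_vert_of_ne _ h]
  | ghost_mul_edge e f =>
    by_cases h : B.pos y = G.r f
    · by_cases hef : e = f
      · subst hef
        simp [genMap_edge_of_eq _ h, genMap_ghost_cons _ h, genMap_vert_of_eq _ h]
      · have h' : ¬∃ y', B.pos y' = G.r e ∧ B.cons e y' = B.cons f y := by
          rintro ⟨y', h', h''⟩
          exact hef (B.cons_inj _ _ _ _ h' h h'').1
        simp [hef, genMap_edge_of_eq _ h, genMap_ghost_of_not _ h']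
    · by_cases hef : e = f
      · subst hef
        simp [genMap_edge_of_ne _ h, genMap_vert_of_ne _ h]
      · simp [hef, genMap_edge_of_ne _ h]
  | sum_edge_mul_ghost x hfin hne =>
    simp only [map_sum, map_mul, FreeAlgebra.lift_ι_apply, LinearMap.sum_apply,
      Module.End.mul_apply]
    by_cases h : B.pos y = x
    · subst h
      obtain ⟨e, y', hy', rfl⟩ := B.exists_cons y hne
      rw [Finset.sum_eq_single_of_mem e (by simp [B.pos_cons _ _ hy']),
        genMap_ghost_cons _ hy', genMap_vert_of_eq _ rfl, genMap_edge_of_eq _ hy']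
      intro f _ hf
      rw [genMap_ghost_of_not, map_zero]
      rintro ⟨z, hz, hz'⟩
      exact hf (B.cons_inj _ _ _ _ hz hy' hz').1
    · rw [genMap_vert_of_ne _ h]
      symm
      refine Finset.sum_eq_zero fun e he => ?_
      rw [genMap_ghost_of_not, map_zero]
      rintro ⟨y', hy', rfl⟩
      exact h (by rw [B.pos_cons _ _ hy']; simpa using he)

variable (F) in
/-- The representation of the Leavitt path algebra on a branching system. -/
noncomputable def rep : LeavittUnitization F G →ₐ[F] Module.End F (Y →₀ F) :=
  RingQuot.liftAlgHom F ⟨FreeAlgebra.lift F (B.genMap F), fun _ _ h => B.genMap_rel h⟩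

@[simp] theorem rep_gen (g : LGen V E) :
    B.rep F (LeavittUnitization.gen F G g) = B.genMap F g := by
  simp [rep, LeavittUnitization.gen]

variable (F) in
/-- The kernel of the representation on the Leavitt path algebra. -/
noncomputable def kerIdeal : TwoSidedIdeal (LeavittPathAlgebra F G) :=
  TwoSidedIdeal.ker ((B.rep F : LeavittUnitization F G →ₙₐ[F] Module.End F (Y →₀ F)).comp
    (NonUnitalSubalgebraClass.subtype (LeavittUnitization.lpa F G)))

theorem mem_kerIdeal {a : LeavittPathAlgebra F G} : a ∈ B.kerIdeal F ↔ B.rep F a.1 = 0 :=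
  TwoSidedIdeal.mem_ker _

theorem vert_mem_kerIdeal {x : V} :
    LeavittPathAlgebra.gen F G (.vert x) ∈ B.kerIdeal F ↔ ∀ y, B.pos y ≠ x := by
  rw [mem_kerIdeal]
  change B.rep F (LeavittUnitization.gen F G _) = 0 ↔ _
  rw [rep_gen]
  constructor
  · intro h y hy
    have := DFunLike.congr_fun h (Finsupp.single y 1)
    rw [genMap_vert_of_eq _ hy] at this
    simp at this
  · intro h
    refine Finsupp.lhom_ext' fun y => LinearMap.ext_ring ?_
    simpa using genMap_vert_of_ne _ (h y)

end BranchingSystem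

/-- Hereditary and saturated sets of vertices (of a row-finite graph). -/
def IsHereditarySaturated (G : DirGraph V E) (H : Set V) : Prop :=
  ∀ x, (∃ e, G.s e = x) → (x ∈ H ↔ ∀ e, G.s e = x → G.r e ∈ H)

/-- A bijection `S × ℕ ≃ ℕ` splits `ℕ` into copies of itself indexed by `S`. Thus the countably many
points over a vertex can be shared out among its edges. -/
theorem exists_branching_of_countable (S : Set E) (hS : S.Countable) :
    ∃ f : E → ℕ → ℕ, (∀ e ∈ S, ∀ e' ∈ S, ∀ m n, f e m = f e' n → e = e' ∧ m = n) ∧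
      (S.Nonempty → ∀ k, ∃ e ∈ S, ∃ n, f e n = k) := by
  classical
  by_cases h : S.Nonempty
  · have := hS.to_subtype
    have := h.to_subtype
    obtain ⟨φ⟩ := nonempty_equiv_of_countable (α := S × ℕ) (β := ℕ)
    refine ⟨fun e n => if he : e ∈ S then φ (⟨e, he⟩, n) else 0, ?_, fun _ k => ?_⟩
    · intro e he e' he' m n
      simp [he, he']
    · exact ⟨(φ.symm k).1, (φ.symm k).1.2, (φ.symm k).2, by simp⟩
  · rw [Set.not_nonempty_iff_eq_empty] at h
    subst h
    exact ⟨fun _ _ => 0, by simp, by simp⟩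

/-- A hereditary saturated set of vertices is the set of vertices without points in some
branching system. -/
theorem exists_branchingSystem (hG : G.RowFinite) {H : Set V} (hH : G.IsHereditarySaturated H) :
    ∃ B : BranchingSystem G ({x : V // x ∉ H} × ℕ), ∀ x, x ∈ H ↔ ∀ y, B.pos y ≠ x := by
  classical
  choose f hinj hsurj using fun x : V => exists_branching_of_countable
    {e : E | G.s e = x ∧ G.r e ∉ H} ((hG x).subset fun e he => he.1).countable
  have hs : ∀ e, G.r e ∉ H → G.s e ∉ H := fun e he hse =>
    he ((hH _ ⟨e, rfl⟩).1 hse e rfl)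
  refine ⟨{
    pos := fun y => y.1
    -- There are no points over vertices of `H`, so the value `y` for edges into `H` is never used.
    cons := fun e y => if he : G.r e ∉ H then (⟨G.s e, hs e he⟩, f (G.s e) e y.2) else y
    pos_cons := ?_
    cons_inj := ?_
    exists_cons := ?_ }, ?_⟩
  · rintro e ⟨⟨x, hx⟩, n⟩ h
    simp only at h
    subst h
    simp [hx]
  · rintro e ⟨⟨x, hx⟩, n⟩ e' ⟨⟨x', hx'⟩, n'⟩ h h' heq
    simp only at h h'
    subst h h'
    simp only [hx, hx', not_false_eq_true, dite_true, Prod.mk.injEq, Subtype.mk.injEq] at heq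
    obtain ⟨h1, h2⟩ := heq
    rw [← h1] at h2
    obtain ⟨rfl, rfl⟩ := hinj (G.s e) e ⟨rfl, hx⟩ e' ⟨h1.symm, hx'⟩ _ _ h2
    exact ⟨rfl, rfl⟩
  · rintro ⟨⟨x, hx⟩, n⟩ hne
    -- Saturation: a vertex outside `H` that is not a sink has an edge whose range is outside `H`.
    have : {e : E | G.s e = x ∧ G.r e ∉ H}.Nonempty := by
      by_contra hc
      apply hx
      rw [hH x hne]
      intro e he
      by_contra her
      exact hc ⟨e, he, her⟩
    obtain ⟨e, ⟨rfl, her⟩, k, hk⟩ := hsurj x this n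
    exact ⟨e, (⟨G.r e, her⟩, k), rfl, by simp [her, hk]⟩
  · intro x
    constructor
    · rintro hx ⟨⟨y, hy⟩, n⟩ rfl
      exact hy hx
    · intro h
      by_contra hx
      exact h (⟨x, hx⟩, 0) rfl

/-- The branching system for the empty set has points over every vertex, so every vertex acts
nontrivially. -/
theorem LeavittPathAlgebra.vert_ne_zero (hG : G.RowFinite) (x : V) :
    LeavittPathAlgebra.gen F G (.vert x) ≠ 0 := by
  intro h
  obtain ⟨B, hB⟩ := exists_branchingSystem hG (H := ∅)
    (fun x ⟨e, he⟩ => by simpa using ⟨e, he⟩)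
  have h1 : LeavittPathAlgebra.gen F G (.vert x) ∈ B.kerIdeal F := h ▸ zero_mem _
  rw [B.vert_mem_kerIdeal, ← hB] at h1
  exact h1

/-! ### Infinite paths -/

/-- The infinite paths of a graph. -/
def InfinitePath (G : DirGraph V E) : Type v := {x : ℕ → E // ∀ n, G.r (x n) = G.s (x (n + 1))}

/-- Prolong an infinite path to the left. -/
def InfinitePath.cons (e : E) (x : G.InfinitePath) (h : G.s (x.1 0) = G.r e) : G.InfinitePath :=
  ⟨fun n => Nat.casesOn n e x.1, fun n => by
    cases n with
    | zero => exact h.symm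
    | succ n => exact x.2 n⟩

open Classical in
/-- The infinite paths with an integer label, which grows by `d` when an edge is added. -/
noncomputable def infinitePathSystem (G : DirGraph V E) (d : ℤ) :
    BranchingSystem G (G.InfinitePath × ℤ) where
  pos y := G.s (y.1.1 0)
  cons e y := if h : G.s (y.1.1 0) = G.r e then (y.1.cons e h, y.2 + d) else y
  pos_cons e y h := by simp [h, InfinitePath.cons]
  cons_inj := by
    rintro e ⟨⟨x, hx⟩, k⟩ e' ⟨⟨x', hx'⟩, k'⟩ h h' heq
    simp only at h h'
    simp only [h, h', dite_true] at heq
    have h1 := congrArg (fun y => y.1.1) heq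
    have h2 := congrArg Prod.snd heq
    have h3 : e = e' := congrFun h1 0
    have h4 : x = x' := funext fun n => congrFun h1 (n + 1)
    exact ⟨h3, Prod.ext (Subtype.ext h4) (add_right_cancel h2)⟩
  exists_cons := by
    rintro ⟨⟨x, hx⟩, k⟩ -
    refine ⟨x 0, (⟨fun n => x (n + 1), fun n => hx (n + 1)⟩, k - d), (hx 0).symm, ?_⟩
    simp only [(hx 0).symm, dite_true]
    refine Prod.ext (Subtype.ext (funext fun n => ?_)) (sub_add_cancel _ _)
    cases n <;> rfl

open LeavittUnitization

theorem exists_rep_pathElt (d : ℤ) {x z : V} {p : List E} (hp : G.IsPath x z p)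
    (y : G.InfinitePath × ℤ) (hy : G.s (y.1.1 0) = z) :
    ∃ y' : G.InfinitePath × ℤ, G.s (y'.1.1 0) = x ∧ y'.2 = y.2 + p.length * d ∧
      (G.infinitePathSystem d).rep F (pathElt F G p) (Finsupp.single y 1) =
        Finsupp.single y' 1 := by
  induction hp with
  | nil => exact ⟨y, hy, by simp, by simp⟩
  | @cons e z p hp ih =>
    obtain ⟨y', h1, h2, h3⟩ := ih hy
    refine ⟨(G.infinitePathSystem d).cons e y', (G.infinitePathSystem d).pos_cons e y' h1, ?_, ?_⟩
    · simp only [infinitePathSystem, h1, dite_true, h2, List.length_cons]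
      push_cast
      ring
    · rw [pathElt_cons, map_mul, Module.End.mul_apply, h3, edge, BranchingSystem.rep_gen,
        BranchingSystem.genMap_edge_of_eq _ h1]

/-- For a closed path this lets every edge be followed by another edge of the path, without cyclic
indexing. -/
theorem IsPath.exists_source_eq {x z : V} {p : List E} (hp : G.IsPath x z p) :
    ∀ e ∈ p, G.r e = z ∨ ∃ f ∈ p, G.s f = G.r e := by
  induction hp with
  | nil => simp
  | @cons e z p hp ih =>
    intro f hf
    rcases List.mem_cons.1 hf with rfl | hf
    · cases p with
      | nil => exact .inl (IsPath.nil_iff.1 hp)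
      | cons g _ => exact .inr ⟨g, by simp, (IsPath.cons_iff.1 hp).1.symm⟩
    · rcases ih f hf with h | ⟨g, hg, h⟩
      · exact .inl h
      · exact .inr ⟨g, by simp [hg], h⟩

/-- A closed path without exits carries exactly one infinite path. -/
theorem exists_unique_infinitePath {x : V} {p : List E} (hp : G.IsPath x x p) (hne : p ≠ [])
    (hexit : ∀ e ∈ p, ∀ f, G.s f = G.s e → f = e) :
    ∃ ξ : G.InfinitePath, G.s (ξ.1 0) = x ∧ ∀ ξ' : G.InfinitePath, G.s (ξ'.1 0) = x → ξ' = ξ := by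
  obtain ⟨e₀, he₀, hs₀⟩ : ∃ e ∈ p, G.s e = x := by
    cases hp with
    | nil => simp at hne
    | @cons e _ _ _ => exact ⟨e, by simp, rfl⟩
  have hstep : ∀ e : {e // e ∈ p}, ∃ f : {e // e ∈ p}, G.s f.1 = G.r e.1 := by
    rintro ⟨e, he⟩
    rcases hp.exists_source_eq e he with h | ⟨f, hf, h⟩
    · exact ⟨⟨e₀, he₀⟩, hs₀.trans h.symm⟩
    · exact ⟨⟨f, hf⟩, h⟩
  choose next hnext using hstep
  refine ⟨⟨fun n => (next^[n] ⟨e₀, he₀⟩).1, fun n => ?_⟩, hs₀, ?_⟩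
  · simp only [Function.iterate_succ_apply', hnext]
  · rintro ⟨ξ, hξ⟩ h
    refine Subtype.ext (funext fun n => ?_)
    change ξ n = (next^[n] ⟨e₀, he₀⟩).1
    induction n with
    | zero => exact hexit _ he₀ _ (h.trans hs₀.symm)
    | succ n ih =>
      rw [Function.iterate_succ_apply']
      refine hexit _ (next _).2 _ ?_
      rw [hnext, ← ih, hξ]

/-- If the Leavitt path algebra is simple, then closed paths have exits. -/
theorem closedPathsHaveExits_of_isSimpleRing (h : IsSimpleRing (G.LeavittPathAlgebra F)) :
    G.ClosedPathsHaveExits := by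
  by_contra hc
  unfold ClosedPathsHaveExits at hc
  push Not at hc
  obtain ⟨x, p, hp, hne, hexit⟩ := hc
  replace hexit : ∀ e ∈ p, ∀ f, G.s f = G.s e → f = e := fun e he f hf => by
    by_contra hfe
    exact hexit e he f hfe hf
  obtain ⟨ξ, hξ, huniq⟩ := exists_unique_infinitePath hp hne hexit
  -- The element `p - x`. Since `ξ` is the only infinite path from `x`, prolonging by `p` fixes it.
  -- With label increment `0` the element acts as zero; with increment `1` it moves the label by the
  -- length of `p`, so it is not zero.
  let a : G.LeavittPathAlgebra F :=
    ⟨pathElt F G p * vert F G x - vert F G x, sub_mem (pathElt_mem hp) (vert_mem x)⟩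
  have hact : ∀ d k, (G.infinitePathSystem d).rep F a.1 (Finsupp.single (ξ, k) 1) =
      Finsupp.single (ξ, k + p.length * d) 1 - Finsupp.single (ξ, k) 1 := by
    intro d k
    obtain ⟨⟨ξ', k'⟩, h1, h2, h3⟩ := exists_rep_pathElt (F := F) d hp (ξ, k) hξ
    obtain rfl := huniq ξ' h1
    simp only at h2
    subst h2
    change (G.infinitePathSystem d).rep F (pathElt F G p * vert F G x - vert F G x) _ = _
    rw [map_sub, map_mul, LinearMap.sub_apply, Module.End.mul_apply, vert,
      BranchingSystem.rep_gen, BranchingSystem.genMap_vert_of_eq _ hξ, h3]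
  have ha : a ∈ (G.infinitePathSystem 0).kerIdeal F := by
    rw [BranchingSystem.mem_kerIdeal]
    refine Finsupp.lhom_ext' fun ⟨ξ', k⟩ => LinearMap.ext_ring ?_
    simp only [LinearMap.comp_apply, Finsupp.lsingle_apply, LinearMap.zero_apply]
    by_cases hξ' : G.s (ξ'.1 0) = x
    · obtain rfl := huniq ξ' hξ'
      rw [hact]
      simp
    · change (G.infinitePathSystem 0).rep F (pathElt F G p * vert F G x - vert F G x) _ = _
      rw [map_sub, map_mul, LinearMap.sub_apply, Module.End.mul_apply, vert,
        BranchingSystem.rep_gen, BranchingSystem.genMap_vert_of_ne _ hξ']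
      simp
  have ha0 : a ≠ 0 := by
    intro h0
    have := hact 1 0
    have h00 : a.1 = 0 := congrArg Subtype.val h0
    rw [h00, map_zero, LinearMap.zero_apply, eq_comm, sub_eq_zero,
      Finsupp.single_left_inj one_ne_zero] at this
    simp [hne] at this
  rcases h.simple.eq_bot_or_eq_top ((G.infinitePathSystem 0).kerIdeal F) with h0 | h1
  · rw [h0] at ha
    exact ha0 (by simpa using ha)
  · have hx : LeavittPathAlgebra.gen F G (.vert x) ∈ (G.infinitePathSystem 0).kerIdeal F := by
      rw [h1]; trivial
    rw [BranchingSystem.vert_mem_kerIdeal] at hx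
    exact hx (ξ, 0) hξ

end DirGraph

/-! ### The graded graph monoid -/

namespace DirGraph

variable {V : Type u} {E : Type v} {G : DirGraph V E}

namespace GrMonoid

/-- The quotient map from the free abelian monoid. -/
def mk (G : DirGraph V E) : Multiset (V × ℤ) →+ GrMonoid G := (grCon G).mk'

theorem mk_singleton (x : V) (i : ℤ) : mk G {(x, i)} = of G x i := rfl

theorem mk_surjective : Function.Surjective (mk G) := AddCon.mk'_surjective

theorem act_mk (n : ℤ) (a : Multiset (V × ℤ)) : G.act n (mk G a) = mk G (shiftFree V n a) := rfl

theorem act_of (n : ℤ) (x : V) (i : ℤ) : G.act n (of G x i) = of G x (i + n) := rfl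

theorem of_eq_sum (x : V) (i : ℤ) (hfin : {e : E | G.s e = x}.Finite)
    (hne : {e : E | G.s e = x}.Nonempty) :
    of G x i = ∑ e ∈ hfin.toFinset, of G (G.r e) (i + 1) := by
  have h : mk G {(x, i)} = mk G (∑ e ∈ hfin.toFinset, {(G.r e, i + 1)}) :=
    (AddCon.eq _).2 (AddConGen.Rel.of _ _ (GrRel.expand x i hfin hne))
  rw [map_sum] at h
  exact h

/-- The universal property of the graded graph monoid. -/
def lift {N : Type*} [AddCommMonoid N] (f : V → ℤ → N)
    (hf : ∀ x i (hfin : {e : E | G.s e = x}.Finite), {e : E | G.s e = x}.Nonempty →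
      f x i = ∑ e ∈ hfin.toFinset, f (G.r e) (i + 1)) : GrMonoid G →+ N :=
  (grCon G).lift (Multiset.sumAddMonoidHom.comp (Multiset.mapAddMonoidHom fun p => f p.1 p.2)) <| by
    refine AddCon.addConGen_le.2 ?_
    rintro _ _ ⟨x, i, hfin, hne⟩
    rw [AddCon.ker_apply, map_sum]
    simpa using hf x i hfin hne

theorem lift_of {N : Type*} [AddCommMonoid N] (f : V → ℤ → N)
    (hf : ∀ x i (hfin : {e : E | G.s e = x}.Finite), {e : E | G.s e = x}.Nonempty →
      f x i = ∑ e ∈ hfin.toFinset, f (G.r e) (i + 1)) (x : V) (i : ℤ) :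
    lift (G := G) f @hf (of G x i) = f x i := by
  change (Multiset.map (fun p : V × ℤ => f p.1 p.2) {(x, i)}).sum = f x i
  simp

theorem act_add (n : ℤ) (a b : GrMonoid G) : G.act n (a + b) = G.act n a + G.act n b :=
  smul_add _ _ _

theorem act_act (m n : ℤ) (a : GrMonoid G) : G.act m (G.act n a) = G.act (m + n) a :=
  (mul_smul (Multiplicative.ofAdd m) (Multiplicative.ofAdd n) a).symm

theorem act_zero (a : GrMonoid G) : G.act 0 a = a := one_smul _ a

theorem act_le {a b : GrMonoid G} (n : ℤ) (h : AlgLE a b) : AlgLE (G.act n a) (G.act n b) := by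
  obtain ⟨c, rfl⟩ := h
  exact ⟨G.act n c, act_add n a c⟩

theorem algLE_trans {a b c : GrMonoid G} (h : AlgLE a b) (h' : AlgLE b c) : AlgLE a c := by
  obtain ⟨d, rfl⟩ := h
  obtain ⟨e, rfl⟩ := h'
  exact ⟨d + e, add_assoc _ _ _⟩

/-- The map to `{0, ∞}` which vanishes on a hereditary saturated set. -/
theorem exists_hom {H : Set V} (hH : G.IsHereditarySaturated H) :
    ∃ φ : GrMonoid G →+ ℕ∞, (∀ x i, φ (of G x i) = 0 ↔ x ∈ H) ∧ ∀ n a, φ (G.act n a) = φ a := by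
  classical
  let φ : GrMonoid G →+ ℕ∞ := lift (fun x _ => if x ∈ H then 0 else ⊤) <| by
    rintro x i hfin ⟨e, he⟩
    split_ifs with h
    · symm
      refine Finset.sum_eq_zero fun f hf => if_pos ?_
      exact (hH x ⟨e, he⟩).1 h f (by simpa using hf)
    · rw [hH x ⟨e, he⟩] at h
      push Not at h
      -- By saturation one summand is `⊤`, which absorbs the rest of the sum.
      obtain ⟨f, hf, hfH⟩ := h
      symm
      rw [eq_top_iff]
      have := Finset.single_le_sum (f := fun e => if G.r e ∈ H then (0 : ℕ∞) else ⊤)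
        (s := hfin.toFinset) (fun _ _ => zero_le) (a := f) (by simpa using hf)
      simpa [hfH] using this
  have hφ : ∀ x i, φ (of G x i) = if x ∈ H then 0 else ⊤ := lift_of _ _
  refine ⟨φ, fun x i => by rw [hφ]; split_ifs with h <;> simp [h], fun n a => ?_⟩
  have h : (φ.comp (shift G n)).comp (mk G) = φ.comp (mk G) := by
    refine Multiset.addHom_ext ?_
    rintro ⟨x, i⟩
    exact (hφ x (i + n)).trans (hφ x i).symm
  obtain ⟨a, rfl⟩ := mk_surjective a
  exact DFunLike.congr_fun h a

theorem of_ne_zero (x : V) (i : ℤ) : of G x i ≠ 0 := by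
  obtain ⟨φ, hφ, -⟩ := exists_hom (G := G) (H := ∅) (fun x ⟨e, he⟩ => by simpa using ⟨e, he⟩)
  intro h
  have := (hφ x i).1 (by rw [h, map_zero])
  exact this

/-- An order-ideal is determined by the vertices `x` with `x(0)` in it, and these form a hereditary
saturated set. Conversely, the kernel of the `{0, ∞}`-valued homomorphism of `exists_hom` is an
order-ideal with the prescribed vertices. -/
theorem isSimpleMonoid_iff (hG : G.RowFinite) :
    IsSimpleMonoid (Multiplicative ℤ) G.GrMonoid ↔
      ∀ H : Set V, G.IsHereditarySaturated H → H = ∅ ∨ H = Set.univ := by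
  constructor
  · intro h H hH
    obtain ⟨φ, hφ, hact⟩ := exists_hom hH
    have hI : IsOrderIdeal (Multiplicative ℤ) (AddMonoidHom.mker φ) := by
      refine ⟨fun n a ha => ?_, ?_⟩
      · rw [AddMonoidHom.mem_mker] at ha ⊢
        exact (hact n.toAdd a).trans ha
      · rintro a _ ⟨c, rfl⟩ hb
        rw [AddMonoidHom.mem_mker, map_add, add_eq_zero] at hb
        exact hb.1
    rcases h _ hI with h0 | h1
    · left
      ext x
      simp only [Set.mem_empty_iff_false, iff_false]
      intro hx
      have : of G x 0 ∈ AddMonoidHom.mker φ := (hφ x 0).2 hx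
      rw [h0] at this
      exact of_ne_zero x 0 this
    · right
      ext x
      simp only [Set.mem_univ, iff_true]
      have : of G x 0 ∈ AddMonoidHom.mker φ := by rw [h1]; trivial
      exact (hφ x 0).1 this
  · intro h I hI
    have hshift : ∀ x i j, of G x i ∈ I → of G x j ∈ I := fun x i j hx => by
      have := hI.1 (Multiplicative.ofAdd (j - i)) _ hx
      have h2 : Multiplicative.ofAdd (j - i) • of G x i = of G x j := by
        change of G x (i + (j - i)) = _
        rw [add_sub_cancel]
      rwa [h2] at this
    have hH : G.IsHereditarySaturated {x | of G x 0 ∈ I} := by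
      intro x hne
      change of G x 0 ∈ I ↔ ∀ e, G.s e = x → of G (G.r e) 0 ∈ I
      rw [of_eq_sum x 0 (hG x) hne]
      constructor
      · intro hx e he
        refine hshift _ (0 + 1) _ (hI.2 _ _ ?_ hx)
        classical
        exact ⟨_, (Finset.add_sum_erase _ _ (by simpa using he)).symm⟩
      · intro hx
        exact sum_mem fun e he => hshift _ 0 _ (hx e (by simpa using he))
    rcases h _ hH with h0 | h1
    · left
      rw [eq_bot_iff]
      intro a ha
      obtain ⟨a, rfl⟩ := mk_surjective a
      induction a using Multiset.induction with
      | empty => exact map_zero _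
      | cons p a _ =>
        exfalso
        have : of G p.1 p.2 ∈ I := hI.2 _ _ ⟨mk G a, by
          rw [← Multiset.singleton_add, map_add]; rfl⟩ ha
        have : p.1 ∈ {x | of G x 0 ∈ I} := hshift _ _ 0 this
        rw [h0] at this
        exact this
    · right
      rw [eq_top_iff]
      rintro a -
      obtain ⟨a, rfl⟩ := mk_surjective a
      induction a using Multiset.induction with
      | empty => rw [map_zero]; exact zero_mem _
      | cons p a ih =>
        rw [← Multiset.singleton_add, map_add]
        refine add_mem ?_ ih
        have : p.1 ∈ {x | of G x 0 ∈ I} := by rw [h1]; trivial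
        exact hshift _ _ p.2 this

/-! ### Expanding vertices up to a given level -/

open Classical in
/-- Replace a vertex by the ranges of the edges it emits; sinks are kept. -/
noncomputable def stepOne (hG : G.RowFinite) (p : V × ℤ) : Multiset (V × ℤ) :=
  if ∃ e, G.s e = p.1 then ∑ e ∈ (hG p.1).toFinset, {(G.r e, p.2 + 1)} else {p}

/-- Apply `stepOne` to all elements. -/
noncomputable def step (hG : G.RowFinite) : Multiset (V × ℤ) →+ Multiset (V × ℤ) :=
  Multiset.sumAddMonoidHom.comp (Multiset.mapAddMonoidHom (stepOne hG))

/-- Expand all vertices of level below `N` up to the level `N`. -/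
noncomputable def expandTo (hG : G.RowFinite) (N : ℤ) : Multiset (V × ℤ) →+ Multiset (V × ℤ) :=
  Multiset.sumAddMonoidHom.comp
    (Multiset.mapAddMonoidHom fun p => (step hG)^[(N - p.2).toNat] {p})

variable (hG : G.RowFinite)

theorem step_singleton (p : V × ℤ) : step hG {p} = stepOne hG p := by simp [step]

theorem step_cons (p : V × ℤ) (a : Multiset (V × ℤ)) :
    step hG (p ::ₘ a) = stepOne hG p + step hG a := by simp [step]

theorem expandTo_singleton (N : ℤ) (p : V × ℤ) :
    expandTo hG N {p} = (step hG)^[(N - p.2).toNat] {p} := by simp [expandTo]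

theorem expandTo_cons (N : ℤ) (p : V × ℤ) (a : Multiset (V × ℤ)) :
    expandTo hG N (p ::ₘ a) = (step hG)^[(N - p.2).toNat] {p} + expandTo hG N a := by
  simp [expandTo]

theorem stepOne_of_sink {p : V × ℤ} (h : ¬∃ e, G.s e = p.1) : stepOne hG p = {p} := if_neg h

theorem mem_stepOne {p q : V × ℤ} (h : ∃ e, G.s e = p.1) :
    q ∈ stepOne hG p ↔ ∃ e, G.s e = p.1 ∧ q = (G.r e, p.2 + 1) := by
  rw [stepOne, if_pos h, Multiset.mem_sum]
  simp

theorem card_stepOne {p : V × ℤ} (h : ∃ e, G.s e = p.1) :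
    Multiset.card (stepOne hG p) = (hG p.1).toFinset.card := by
  rw [stepOne, if_pos h]
  simp

theorem one_le_card_stepOne (p : V × ℤ) : 1 ≤ Multiset.card (stepOne hG p) := by
  by_cases h : ∃ e, G.s e = p.1
  · rw [card_stepOne hG h, Nat.one_le_iff_ne_zero, ← Nat.pos_iff_ne_zero, Finset.card_pos]
    obtain ⟨e, he⟩ := h
    exact ⟨e, by simpa using he⟩
  · rw [stepOne_of_sink hG h]; simp

theorem mem_step {a : Multiset (V × ℤ)} {q : V × ℤ} :
    q ∈ step hG a ↔ ∃ p ∈ a, q ∈ stepOne hG p := by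
  induction a using Multiset.induction with
  | empty => simp
  | cons p a ih => simp [step_cons, ih]

theorem card_le_card_step (a : Multiset (V × ℤ)) :
    Multiset.card a ≤ Multiset.card (step hG a) := by
  induction a using Multiset.induction with
  | empty => simp
  | cons p a ih =>
    rw [step_cons, Multiset.card_add, Multiset.card_cons]
    have := one_le_card_stepOne hG p
    omega

/-- No element shrinks in number under `stepOne`, so equality of the totals forces equality for each
element. -/
theorem card_stepOne_eq_one {a : Multiset (V × ℤ)}
    (h : Multiset.card (step hG a) = Multiset.card a) {p : V × ℤ} (hp : p ∈ a) :
    Multiset.card (stepOne hG p) = 1 := by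
  obtain ⟨b, rfl⟩ := Multiset.exists_cons_of_mem hp
  rw [step_cons, Multiset.card_add, Multiset.card_cons] at h
  have := one_le_card_stepOne hG p
  have := card_le_card_step hG b
  omega

theorem shiftFree_singleton (n : ℤ) (p : V × ℤ) :
    shiftFree V n {p} = {(p.1, p.2 + n)} := by simp [shiftFree]

theorem shiftFree_cons (n : ℤ) (p : V × ℤ) (a : Multiset (V × ℤ)) :
    shiftFree V n (p ::ₘ a) = (p.1, p.2 + n) ::ₘ shiftFree V n a := by simp [shiftFree]

theorem mem_shiftFree {n : ℤ} {p : V × ℤ} {a : Multiset (V × ℤ)} :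
    p ∈ shiftFree V n a ↔ (p.1, p.2 - n) ∈ a := by
  simp only [shiftFree, Multiset.coe_mapAddMonoidHom, Multiset.mem_map]
  constructor
  · rintro ⟨q, hq, rfl⟩
    simpa using hq
  · intro h
    exact ⟨_, h, by simp⟩

theorem card_shiftFree (n : ℤ) (a : Multiset (V × ℤ)) :
    Multiset.card (shiftFree V n a) = Multiset.card a := by simp [shiftFree]

theorem step_shiftFree (n : ℤ) (a : Multiset (V × ℤ)) :
    step hG (shiftFree V n a) = shiftFree V n (step hG a) := by
  induction a using Multiset.induction with
  | empty => simp
  | cons p a ih =>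
    rw [shiftFree_cons, step_cons, step_cons, map_add, ih]
    congr 1
    simp only [stepOne]
    split_ifs
    · rw [map_sum]
      refine Finset.sum_congr rfl fun e _ => ?_
      rw [shiftFree_singleton, add_right_comm]
    · rw [shiftFree_singleton]

theorem iterate_step_shiftFree (k : ℕ) (n : ℤ) (a : Multiset (V × ℤ)) :
    (step hG)^[k] (shiftFree V n a) = shiftFree V n ((step hG)^[k] a) := by
  induction k generalizing a with
  | zero => rfl
  | succ k ih => rw [Function.iterate_succ_apply, step_shiftFree, ih, Function.iterate_succ_apply]

theorem expandTo_shiftFree (N n : ℤ) (a : Multiset (V × ℤ)) :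
    expandTo hG N (shiftFree V n a) = shiftFree V n (expandTo hG (N - n) a) := by
  induction a using Multiset.induction with
  | empty => simp
  | cons p a ih =>
    rw [shiftFree_cons, expandTo_cons, expandTo_cons, map_add, ih, ← iterate_step_shiftFree,
      shiftFree_singleton]
    simp only [sub_sub, add_comm]

theorem mk_stepOne (p : V × ℤ) : mk G (stepOne hG p) = mk G {p} := by
  unfold stepOne
  split_ifs with h
  · rw [map_sum]
    exact (of_eq_sum p.1 p.2 (hG p.1) h).symm
  · rfl

theorem mk_step (a : Multiset (V × ℤ)) : mk G (step hG a) = mk G a := by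
  induction a using Multiset.induction with
  | empty => simp
  | cons p a ih => rw [step_cons, map_add, ih, mk_stepOne, ← map_add, Multiset.singleton_add]

theorem mk_expandTo (N : ℤ) (a : Multiset (V × ℤ)) : mk G (expandTo hG N a) = mk G a := by
  induction a using Multiset.induction with
  | empty => simp
  | cons p a ih =>
    have h : ∀ k (b : Multiset (V × ℤ)), mk G ((step hG)^[k] b) = mk G b := fun k => by
      induction k with
      | zero => simp
      | succ k ih => intro b; rw [Function.iterate_succ_apply, ih, mk_step]
    rw [expandTo_cons, map_add, ih, h, ← map_add, Multiset.singleton_add]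

/-- The truncation `toNat` leaves elements above level `N` alone, so `N` must have reached every
level occurring in `a`. -/
theorem exists_expandTo_succ (a : Multiset (V × ℤ)) :
    ∃ N₀, ∀ N ≥ N₀, expandTo hG (N + 1) a = step hG (expandTo hG N a) := by
  induction a using Multiset.induction with
  | empty => exact ⟨0, by simp⟩
  | cons p a ih =>
    obtain ⟨N₀, h⟩ := ih
    refine ⟨max N₀ p.2, fun N hN => ?_⟩
    rw [expandTo_cons, expandTo_cons, map_add, h N (le_trans (le_max_left _ _) hN)]
    have h1 : (N + 1 - p.2).toNat = (N - p.2).toNat + 1 := by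
      have := le_trans (le_max_right _ _) hN
      omega
    rw [h1, Function.iterate_succ_apply']

/-- Having equal expansions from some level on is a congruence, and it contains the defining
relations: expanding `x(i)` once is the first step of expanding it to a level `N ≥ i + 1`. -/
theorem exists_expandTo_eq {a b : Multiset (V × ℤ)} (h : mk G a = mk G b) :
    ∃ N₀, ∀ N ≥ N₀, expandTo hG N a = expandTo hG N b := by
  let c : AddCon (Multiset (V × ℤ)) :=
    { r := fun a b => ∃ N₀, ∀ N ≥ N₀, expandTo hG N a = expandTo hG N b
      iseqv :=
        { refl := fun a => ⟨0, fun _ _ => rfl⟩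
          symm := fun ⟨N, h⟩ => ⟨N, fun M hM => (h M hM).symm⟩
          trans := fun ⟨N, h⟩ ⟨N', h'⟩ => ⟨max N N', fun M hM =>
            (h M (le_trans (le_max_left _ _) hM)).trans
              (h' M (le_trans (le_max_right _ _) hM))⟩ }
      add' := fun ⟨N, h⟩ ⟨N', h'⟩ => ⟨max N N', fun M hM => by
        rw [map_add, map_add, h M (le_trans (le_max_left _ _) hM),
          h' M (le_trans (le_max_right _ _) hM)]⟩ }
  have hc : grCon G ≤ c := by
    refine AddCon.addConGen_le.2 ?_
    rintro _ _ ⟨x, i, hfin, hne⟩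
    refine ⟨i + 1, fun N hN => ?_⟩
    have h1 : (N - i).toNat = (N - (i + 1)).toNat + 1 := by omega
    have h2 : stepOne hG (x, i) = ∑ e ∈ hfin.toFinset, {(G.r e, i + 1)} := if_pos hne
    rw [expandTo_singleton, map_sum, h1, Function.iterate_succ_apply, step_singleton, h2]
    simp only [expandTo_singleton]
    exact map_sum (⟨⟨(step hG)^[(N - (i + 1)).toNat], iterate_map_zero (step hG) _⟩,
      fun a b => iterate_map_add (step hG) _ a b⟩ : Multiset (V × ℤ) →+ Multiset (V × ℤ)) _ _
  exact hc ((AddCon.eq _).1 h)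

/-- Expansion to a high level turns the equation into one between multisets, where cancellation
holds. -/
theorem add_left_cancel_of_rowFinite (hG : G.RowFinite) {a b c : GrMonoid G}
    (h : a + b = a + c) : b = c := by
  obtain ⟨a, rfl⟩ := mk_surjective a
  obtain ⟨b, rfl⟩ := mk_surjective b
  obtain ⟨c, rfl⟩ := mk_surjective c
  rw [← map_add, ← map_add] at h
  obtain ⟨N, hN⟩ := exists_expandTo_eq hG h
  have := hN N le_rfl
  rw [map_add, map_add, add_right_inj] at this
  rw [← mk_expandTo hG N, this, mk_expandTo]

/-- The homomorphism of `exists_hom` for the empty set sends every generator to a nonzero element of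
`ℕ∞`. -/
theorem eq_zero_of_add_eq_zero {a b : GrMonoid G} (h : a + b = 0) : a = 0 := by
  obtain ⟨φ, hφ, -⟩ := exists_hom (G := G) (H := ∅) (fun x ⟨e, he⟩ => by simpa using ⟨e, he⟩)
  obtain ⟨a, rfl⟩ := mk_surjective a
  induction a using Multiset.induction with
  | empty => exact map_zero _
  | cons p a _ =>
    exfalso
    have h1 := congrArg φ h
    rw [← Multiset.singleton_add, map_add, map_add, map_add, map_zero, add_eq_zero,
      add_eq_zero] at h1
    exact (hφ p.1 p.2).1 h1.1.1

theorem algLE_antisymm (hG : G.RowFinite) {a b : GrMonoid G} (h : AlgLE a b) (h' : AlgLE b a) :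
    a = b := by
  obtain ⟨c, rfl⟩ := h
  obtain ⟨d, hd⟩ := h'
  have h1 : c + d = 0 := add_left_cancel_of_rowFinite hG (a := a) (by
    rw [add_zero, ← add_assoc, ← hd])
  rw [eq_zero_of_add_eq_zero h1, add_zero]

theorem mem_step_path {a : Multiset (V × ℤ)} {q : V × ℤ} (hq : q ∈ step hG a) :
    ∃ p ∈ a, ∃ l, G.IsPath p.1 q.1 l ∧ (l.length : ℤ) = q.2 - p.2 := by
  obtain ⟨p, hp, hpq⟩ := (mem_step hG).1 hq
  refine ⟨p, hp, ?_⟩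
  by_cases h : ∃ e, G.s e = p.1
  · obtain ⟨e, he, rfl⟩ := (mem_stepOne hG h).1 hpq
    exact ⟨[e], by rw [← he]; exact .single e, by simp⟩
  · rw [stepOne_of_sink hG h, Multiset.mem_singleton] at hpq
    subst hpq
    exact ⟨[], .nil _, by simp⟩

/-- If `a` is comparable with a shift of itself, so are its expansions, from some level on. -/
theorem exists_expansion_seq {a : Multiset (V × ℤ)} {n : ℤ} {b c : Multiset (V × ℤ)}
    (h : mk G a + mk G b = G.act n (mk G a) + mk G c) :
    ∃ N₀ : ℤ, ∀ N ≥ N₀, expandTo hG (N + 1) a = step hG (expandTo hG N a) ∧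
      expandTo hG N a + expandTo hG N b =
        shiftFree V n (expandTo hG (N - n) a) + expandTo hG N c := by
  rw [act_mk, ← map_add, ← map_add] at h
  obtain ⟨N, hN⟩ := exists_expandTo_eq hG h
  obtain ⟨N', hN'⟩ := exists_expandTo_succ hG a
  refine ⟨max N N', fun M hM => ⟨hN' M (by omega), ?_⟩⟩
  have := hN M (by omega)
  rwa [map_add, map_add, expandTo_shiftFree] at this

end GrMonoid

end DirGraph

namespace DirGraph

variable {V : Type u} {E : Type v} {G : DirGraph V E}

namespace GrMonoid

/-! ### Comparability of an element with its shifts -/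

variable (hG : G.RowFinite)

/-- Constant cardinality leaves each element one successor, and periodicity up to the shift excludes
sinks. So one can follow forced edges forever; at the times `j * m` only the finitely many vertices
of `h 0` occur, and a repetition closes up a path without exits. -/
theorem exists_closedPath_of_seq {h : ℕ → Multiset (V × ℤ)} {m : ℕ} (hm : 0 < m)
    (hstep : ∀ k, h (k + 1) = step hG (h k))
    (hshift : ∀ k, h k = shiftFree V (-m) (h (k + m)))
    (hcard : ∀ k, Multiset.card (h (k + 1)) = Multiset.card (h k)) (h0 : h 0 ≠ 0) :
    ∃ x p, G.IsPath x x p ∧ p ≠ [] ∧ ∀ e ∈ p, ∀ f, G.s f = G.s e → f = e := by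
  classical
  have hone : ∀ k, ∀ p ∈ h k, Multiset.card (stepOne hG p) = 1 := fun k p hp =>
    card_stepOne_eq_one hG (by rw [← hstep, hcard]) hp
  have hsinks : ∀ k, ∀ p ∈ h k, ∃ e, G.s e = p.1 := by
    intro k p hp
    by_contra hs
    -- A sink stays at its level under `step`. Take a sink of lowest level in `h k`: it persists to
    -- `h (k + m)`, and shifting back by `-m` puts it into `h k` at a lower level.
    have hkeep : ∀ x i, (¬∃ e, G.s e = x) → (x, i) ∈ h k → ∀ j, (x, i) ∈ h (k + j) := by
      intro x i hx hxi j
      induction j with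
      | zero => exact hxi
      | succ j ih =>
        rw [← add_assoc, hstep, mem_step]
        refine ⟨_, ih, ?_⟩
        rw [stepOne_of_sink hG (p := (x, i)) hx]
        simp
    obtain ⟨q, hq, hmin⟩ := ((h k).toFinset.filter fun q => ¬∃ e, G.s e = q.1).exists_min_image
      Prod.snd ⟨p, by simp [hp]; simpa using hs⟩
    rw [Finset.mem_filter, Multiset.mem_toFinset] at hq
    have h1 : (q.1, q.2 - m) ∈ h k := by
      rw [hshift k, mem_shiftFree]
      simpa using hkeep q.1 q.2 hq.2 hq.1 m
    have h2 := hmin (q.1, q.2 - m) (by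
      rw [Finset.mem_filter, Multiset.mem_toFinset]
      exact ⟨h1, hq.2⟩)
    simp only at h2
    omega
  have hnext : ∀ k (p : {p // p ∈ h k}), ∃ q : {q // q ∈ h (k + 1)}, ∃ e, G.s e = p.1.1 ∧
      (∀ f, G.s f = G.s e → f = e) ∧ q.1.1 = G.r e := by
    rintro k ⟨p, hp⟩
    obtain ⟨e, he⟩ := hsinks k p hp
    refine ⟨⟨(G.r e, p.2 + 1), ?_⟩, e, he, fun f hf => ?_, rfl⟩
    · rw [hstep, mem_step]
      exact ⟨p, hp, (mem_stepOne hG ⟨e, he⟩).2 ⟨e, he, rfl⟩⟩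
    · have h1 := hone k p hp
      rw [card_stepOne hG ⟨e, he⟩] at h1
      exact Finset.card_le_one.1 h1.le _ (by simpa using hf.trans he) _ (by simpa using he)
  choose next hnext using hnext
  obtain ⟨p₀, hp₀⟩ := Multiset.exists_mem_of_ne_zero h0
  let q : (k : ℕ) → {p // p ∈ h k} := fun k => Nat.rec ⟨p₀, hp₀⟩ next k
  let u : ℕ → V := fun k => (q k).1.1
  have hpath : ∀ a b, ∃ p, G.IsPath (u a) (u (a + b)) p ∧ p.length = b ∧
      ∀ e ∈ p, ∀ f, G.s f = G.s e → f = e := by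
    intro a b
    induction b with
    | zero => exact ⟨[], .nil _, rfl, by simp⟩
    | succ b ih =>
      obtain ⟨p, hp, hl, hex⟩ := ih
      obtain ⟨e, he, hef, hr⟩ := hnext (a + b) (q (a + b))
      refine ⟨p ++ [e], hp.append ?_, by simp [hl], ?_⟩
      · have : u (a + (b + 1)) = G.r e := hr
        rw [this]
        change G.IsPath (q (a + b)).1.1 _ _
        rw [← he]
        exact .single e
      · intro g hg
        rcases List.mem_append.1 hg with hg | hg
        · exact hex g hg
        · rw [List.mem_singleton] at hg
          subst hg
          exact hef
  have hmem : ∀ j, ∀ p ∈ h (j * m), p.1 ∈ (h 0).toFinset.image Prod.fst := by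
    intro j
    induction j with
    | zero =>
      intro p hp
      rw [zero_mul] at hp
      exact Finset.mem_image_of_mem _ (by simpa using hp)
    | succ j ih =>
      intro p hp
      refine ih (p.1, p.2 - m) ?_
      rw [hshift, mem_shiftFree]
      simpa [add_mul] using hp
  obtain ⟨i, j, hij, huv⟩ := Finite.exists_ne_map_eq_of_infinite
    fun j : ℕ => (⟨u (j * m), hmem j _ (q (j * m)).2⟩ : {x // x ∈ (h 0).toFinset.image Prod.fst})
  replace huv : u (i * m) = u (j * m) := congrArg Subtype.val huv
  wlog hlt : i < j generalizing i j
  · exact this j i hij.symm huv.symm (lt_of_le_of_ne (not_lt.1 hlt) hij.symm)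
  obtain ⟨p, hp, hl, hex⟩ := hpath (i * m) (j * m - i * m)
  have hlt' : i * m < j * m := Nat.mul_lt_mul_of_pos_right hlt hm
  rw [Nat.add_sub_cancel' hlt'.le, ← huv] at hp
  refine ⟨_, p, hp, ?_, hex⟩
  rintro rfl
  simp at hl
  omega

/-- If all closed paths have exits, then a negative shift of `a` is never below `a`. -/
theorem not_act_neg_le (hG : G.RowFinite) (hL : G.ClosedPathsHaveExits) {a : GrMonoid G}
    (ha : a ≠ 0) {n : ℤ} (hn : n < 0) : ¬AlgLE (G.act n a) a := by
  rintro ⟨c, hc⟩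
  obtain ⟨a, rfl⟩ := mk_surjective a
  obtain ⟨c, rfl⟩ := mk_surjective c
  obtain ⟨m, rfl⟩ : ∃ m : ℕ, n = -m := ⟨n.natAbs, by omega⟩
  obtain ⟨N₀, hN₀⟩ := exists_expansion_seq hG (a := a) (n := -m) (b := 0) (c := c) (by
    rw [map_zero, add_zero]; exact hc)
  let h : ℕ → Multiset (V × ℤ) := fun k => expandTo hG (N₀ + k) a
  have hstep : ∀ k, h (k + 1) = step hG (h k) := fun k => by
    have := (hN₀ (N₀ + k) (by omega)).1
    simpa [h, add_assoc] using this
  have hshift : ∀ k, h k = shiftFree V (-m) (h (k + m)) + expandTo hG (N₀ + k) c := fun k => by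
    have := (hN₀ (N₀ + k) (by omega)).2
    rw [map_zero, add_zero] at this
    simpa [h, add_assoc] using this
  have hmono : Monotone fun k => Multiset.card (h k) := monotone_nat_of_le_succ fun k => by
    rw [hstep]; exact card_le_card_step hG _
  -- The cardinalities are nondecreasing in `k`, while this identity bounds a later one by an
  -- earlier one. Hence they are constant and `c` expands to nothing.
  have hle : ∀ k, Multiset.card (h (k + m)) + Multiset.card (expandTo hG (N₀ + k) c) =
      Multiset.card (h k) := fun k => by
    conv_rhs => rw [hshift k, Multiset.card_add, card_shiftFree]
  have hcard : ∀ k, Multiset.card (h (k + 1)) = Multiset.card (h k) := fun k => by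
    have h1 := hle k
    have h2 : Multiset.card (h (k + 1)) ≤ Multiset.card (h (k + m)) := hmono (by omega)
    have h3 : Multiset.card (h k) ≤ Multiset.card (h (k + 1)) := hmono (by omega)
    omega
  have hc0 : ∀ k : ℕ, expandTo hG (N₀ + k) c = 0 := fun k => by
    have h1 := hle k
    have h2 : Multiset.card (h k) ≤ Multiset.card (h (k + m)) := hmono (by omega)
    rw [← Multiset.card_eq_zero]
    omega
  obtain ⟨x, p, hp, hne, hex⟩ := exists_closedPath_of_seq hG (h := h) (m := m) (by omega) hstep
    (fun k => by conv_lhs => rw [hshift k, hc0, add_zero]) hcard (fun h0 => ha (by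
      rw [← mk_expandTo hG (N₀ + (0 : ℕ))]
      change mk G (h 0) = 0
      rw [h0, map_zero]))
  obtain ⟨e, he, f, hf, hs⟩ := hL x p hp hne
  exact hf (hex e he f hs)

/-- In an acyclic graph, a nonzero element is never below a negative shift of itself. -/
theorem eq_zero_of_le_act_neg (hG : G.RowFinite)
    (hac : ∀ x p, G.IsPath x x p → p = []) {a : GrMonoid G} {n : ℤ} (hn : n < 0)
    (hle : AlgLE a (G.act n a)) : a = 0 := by
  classical
  obtain ⟨c, hc⟩ := hle
  obtain ⟨a, rfl⟩ := mk_surjective a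
  obtain ⟨c, rfl⟩ := mk_surjective c
  obtain ⟨m, rfl⟩ : ∃ m : ℕ, n = -m := ⟨n.natAbs, by omega⟩
  obtain ⟨N₀, hN₀⟩ := exists_expansion_seq hG (a := a) (n := -m) (b := c) (c := 0) (by
    rw [map_zero, add_zero]; exact hc.symm)
  let h : ℕ → Multiset (V × ℤ) := fun k => expandTo hG (N₀ + k) a
  have hstep : ∀ k, h (k + 1) = step hG (h k) := fun k => by
    have := (hN₀ (N₀ + k) (by omega)).1
    simpa [h, add_assoc] using this
  have hshift : ∀ k, ∀ p ∈ h k, (p.1, p.2 + m) ∈ h (k + m) := fun k p hp => by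
    have := (hN₀ (N₀ + k) (by omega)).2
    rw [map_zero, add_zero] at this
    have h1 : p ∈ shiftFree V (-m) (h (k + m)) := by
      have h2 : h k + expandTo hG (N₀ + k) c = shiftFree V (-m) (h (k + m)) := by
        simpa [h, add_assoc] using this
      rw [← h2]
      exact Multiset.mem_add.2 (.inl hp)
    simpa [mem_shiftFree] using h1
  -- Iterating the inclusion, every element of `h 0` reappears in `h (j * m)` over the same vertex,
  -- with its level raised by `j * m`.
  have hshift' : ∀ j : ℕ, ∀ p ∈ h 0, (p.1, p.2 + j * m) ∈ h (j * m) := fun j p hp => by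
    induction j with
    | zero => simpa using hp
    | succ j ih =>
      have := hshift _ _ ih
      simp only at this
      convert this using 2
      · ring
      · push_cast; ring
  have hpath : ∀ k, ∀ q ∈ h k, ∃ p ∈ h 0, ∃ l, G.IsPath p.1 q.1 l ∧
      (l.length : ℤ) = q.2 - p.2 := fun k => by
    induction k with
    | zero => exact fun q hq => ⟨q, hq, [], .nil _, by simp⟩
    | succ k ih =>
      intro q hq
      rw [hstep] at hq
      obtain ⟨p, hp, l, hl, hlen⟩ := mem_step_path hG hq
      obtain ⟨p', hp', l', hl', hlen'⟩ := ih p hp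
      exact ⟨p', hp', l' ++ l, hl'.append hl, by rw [List.length_append]; push_cast; omega⟩
  by_contra hne
  have h0 : h 0 ≠ 0 := fun h0 => hne (by
    rw [← mk_expandTo hG (N₀ + (0 : ℕ))]
    change mk G (h 0) = 0
    rw [h0, map_zero])
  obtain ⟨B, hB⟩ : ∃ B : ℕ, ∀ p ∈ h 0, p.2.natAbs ≤ B :=
    ⟨((h 0).map fun p => p.2.natAbs).sum, fun p hp =>
      Multiset.le_sum_of_mem (Multiset.mem_map_of_mem (fun p : V × ℤ => p.2.natAbs) hp)⟩
  let S := {x : V // ∃ i, (x, i) ∈ h 0}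
  have hfin : Finite S := by
    refine Finite.of_injective (β := {x // x ∈ (h 0).toFinset.image Prod.fst})
      (fun x => ⟨x.1, ?_⟩) fun x y hxy => Subtype.ext (by simpa using hxy)
    obtain ⟨i, hi⟩ := x.2
    exact Finset.mem_image_of_mem Prod.fst (a := (x.1, i)) (by simpa using hi)
  let R : S → S → Prop := fun x y => ∃ p, p ≠ [] ∧ G.IsPath x.1 y.1 p
  have htrans : IsTrans S R := ⟨fun x y z ⟨p, hp, hxy⟩ ⟨q, _, hyz⟩ =>
    ⟨p ++ q, by simp [hp], hxy.append hyz⟩⟩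
  have hirr : Std.Irrefl R := ⟨fun x ⟨p, hp, hxx⟩ => hp (hac _ _ hxx)⟩
  obtain ⟨p₀, hp₀⟩ := Multiset.exists_mem_of_ne_zero h0
  -- Acyclicity makes reachability by nonempty paths a strict order on the finite set `S`; take a
  -- minimal `x`.
  obtain ⟨⟨x, i, hi⟩, -, hmin⟩ := (Finite.wellFounded_of_trans_of_irrefl R).has_min Set.univ
    ⟨⟨p₀.1, p₀.2, hp₀⟩, trivial⟩
  -- Levels in `h 0` lie between `-B` and `B`. After a rise of at least `2 * B + 1` the path leading
  -- back to `h 0` has positive length, so its start lies strictly below `x`.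
  obtain ⟨p, hp, l, hl, hlen⟩ := hpath _ _ (hshift' (2 * B + 1) _ hi)
  refine hmin ⟨p.1, p.2, hp⟩ trivial ⟨l, ?_, hl⟩
  rintro rfl
  have h1 := hB _ hp
  have h2 := hB _ hi
  have h3 : (2 * B + 1 : ℤ) * 1 ≤ (2 * B + 1 : ℤ) * m :=
    mul_le_mul_of_nonneg_left (by omega) (by omega)
  simp only [List.length_nil, Nat.cast_zero] at hlen
  push_cast at hlen
  simp only at h2
  omega

/-- Without sinks every generator can be pushed to any higher level, so all elements can be brought
to one common level `N`. -/
theorem exists_eq_mk_of_no_sinks (hG : G.RowFinite) (hs : ∀ x, ∃ e, G.s e = x)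
    (a : GrMonoid G) : ∃ N₀ : ℤ, ∀ N ≥ N₀, ∃ b : Multiset V,
      a = mk G (b.map fun x => (x, N)) := by
  obtain ⟨a, rfl⟩ := mk_surjective a
  induction a using Multiset.induction with
  | empty => exact ⟨0, fun N _ => ⟨0, by simp⟩⟩
  | cons p a ih =>
    obtain ⟨N₀, hN₀⟩ := ih
    have hp : ∀ k : ℕ, ∃ b : Multiset V, of G p.1 p.2 = mk G (b.map fun x => (x, p.2 + k)) := by
      intro k
      induction k with
      | zero => exact ⟨{p.1}, by simp [← mk_singleton]⟩
      | succ k ih =>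
        obtain ⟨b, hb⟩ := ih
        rw [hb]
        clear hb
        induction b using Multiset.induction with
        | empty => exact ⟨0, by simp⟩
        | cons x b ih =>
          obtain ⟨c, hc⟩ := ih
          refine ⟨(∑ e ∈ (hG x).toFinset, {G.r e}) + c, ?_⟩
          rw [Multiset.map_cons, ← Multiset.singleton_add, map_add, hc, Multiset.map_add, map_add,
            mk_singleton, of_eq_sum x _ (hG x) (hs x)]
          congr 1
          rw [← Multiset.coe_mapAddMonoidHom, map_sum, map_sum]
          simp [mk_singleton, add_assoc]
    refine ⟨max N₀ p.2, fun N hN => ?_⟩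
    obtain ⟨b, hb⟩ := hN₀ N (le_trans (le_max_left _ _) hN)
    obtain ⟨k, hk⟩ := Int.eq_ofNat_of_zero_le (sub_nonneg.2 (le_trans (le_max_right _ _) hN))
    obtain ⟨c, hc⟩ := hp k
    refine ⟨c + b, ?_⟩
    rw [← Multiset.singleton_add, map_add, hb, Multiset.map_add, map_add]
    congr 1
    change of G p.1 p.2 = _
    rw [hc, ← hk, add_sub_cancel]

/-- In a graph with finitely many vertices and no sinks, every element lies below a negative
shift of itself. -/
theorem exists_le_act_neg (hG : G.RowFinite) [Finite V] (hs : ∀ x, ∃ e, G.s e = x)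
    (a : GrMonoid G) : ∃ n < 0, AlgLE a (G.act n a) := by
  classical
  obtain ⟨N₀, hN₀⟩ := exists_eq_mk_of_no_sinks hG hs a
  choose b hb using fun k : ℕ => hN₀ (N₀ + k) (by omega)
  -- Dickson's lemma: the multiplicity vectors of `a` at successive levels lie in `ℕ ^ V` with `V`
  -- finite, so an earlier one is below a later one. Moving the later one down by `j - i` levels
  -- compares it with `a`.
  obtain ⟨i, j, hij, hle⟩ := wellQuasiOrdered_le (fun k x => (b k).count x : ℕ → V → ℕ)
  have hle' : b i ≤ b j := Multiset.le_iff_count.2 hle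
  obtain ⟨c, hc⟩ := Multiset.le_iff_exists_add.1 hle'
  refine ⟨i - j, by omega, mk G (c.map fun x => (x, N₀ + i)), ?_⟩
  have h1 : G.act (i - j) a = mk G ((b j).map fun x => (x, N₀ + i)) := by
    conv_lhs => rw [hb j, act_mk]
    congr 1
    simp [shiftFree, Multiset.map_map]
  rw [h1, hc, Multiset.map_add, map_add, ← hb i]

theorem of_path_le (hG : G.RowFinite) {x y : V} {p : List E} (hp : G.IsPath x y p) (i : ℤ) :
    AlgLE (of G y (i + p.length)) (of G x i) := by
  classical
  induction hp generalizing i with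
  | nil => exact ⟨0, by simp⟩
  | @cons e y p hp ih =>
    refine algLE_trans (b := of G (G.r e) (i + 1)) ?_ ?_
    · convert ih (i + 1) using 2
      rw [List.length_cons]
      push_cast
      ring
    · rw [of_eq_sum (G.s e) i (hG _) ⟨e, rfl⟩]
      exact ⟨_, (Finset.add_sum_erase _ _ (by simp)).symm⟩

/-- Along such a path every defining relation has a single summand. -/
theorem of_path_eq (hG : G.RowFinite) {x y : V} {p : List E} (hp : G.IsPath x y p)
    (hex : ∀ e ∈ p, ∀ f, G.s f = G.s e → f = e) (i : ℤ) :
    of G x i = of G y (i + p.length) := by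
  induction hp generalizing i with
  | nil => simp
  | @cons e y p hp ih =>
    have h1 : (hG (G.s e)).toFinset = {e} := by
      ext f
      simp only [Set.Finite.mem_toFinset, Set.mem_ofPred_eq, Finset.mem_singleton]
      exact ⟨hex e (by simp) f, fun h => by rw [h]⟩
    rw [of_eq_sum (G.s e) i (hG _) ⟨e, rfl⟩, h1, Finset.sum_singleton,
      ih (fun f hf => hex f (by simp [hf]))]
    congr 1
    rw [List.length_cons]
    push_cast
    ring

theorem exists_of_eq_act (hG : G.RowFinite) (hL : ¬G.ClosedPathsHaveExits) :
    ∃ (x : V) (m : ℕ), 0 < m ∧ of G x 0 = G.act (-m) (of G x 0) := by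
  unfold ClosedPathsHaveExits at hL
  push Not at hL
  obtain ⟨x, p, hp, hne, hexit⟩ := hL
  refine ⟨x, p.length, List.length_pos_iff.2 hne, ?_⟩
  have h := of_path_eq hG hp (fun e he f hf => by
    by_contra hfe
    exact hexit e he f hfe hf) (-p.length)
  rw [neg_add_cancel] at h
  rw [act_of, zero_add]
  exact h.symm

end GrMonoid

end DirGraph

/-! ### Graded ideals and simplicity -/

namespace DirGraph

variable {V : Type u} {E : Type v} {F : Type w} [Field F] {G : DirGraph V E}

open LeavittUnitization

/-- An ideal generated by homogeneous elements is graded. -/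
theorem isGradedIdeal_span_of_homogeneous {R S : Type*} [NonUnitalRing R] [SetLike S R]
    [AddSubmonoidClass S R] {A : ℤ → S} (hneg : ∀ n, ∀ a ∈ A n, -a ∈ A n)
    (hmul : ∀ m n a b, a ∈ A m → b ∈ A n → a * b ∈ A (m + n))
    (htop : ∀ a, a ∈ AddSubmonoid.closure {a | ∃ n, a ∈ A n}) {s : Set R}
    (hs : ∀ a ∈ s, ∃ n, a ∈ A n) : IsGradedIdeal A (TwoSidedIdeal.span s) := by
  set J : TwoSidedIdeal R := TwoSidedIdeal.span s
  -- The sums of homogeneous elements of `J` form a two-sided ideal containing `s`, hence containing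
  -- `J`.
  let K : AddSubgroup R := AddSubgroup.closure {a | ∃ n, a ∈ A n ∧ a ∈ J}
  have hl : ∀ {a b}, b ∈ K → a * b ∈ K := by
    intro a b hb
    induction hb using AddSubgroup.closure_induction with
    | mem b hb =>
      obtain ⟨n, hb, hbJ⟩ := hb
      induction htop a using AddSubmonoid.closure_induction with
      | mem a ha =>
        obtain ⟨m, ha⟩ := ha
        exact AddSubgroup.subset_closure ⟨_, hmul _ _ _ _ ha hb, J.mul_mem_left _ _ hbJ⟩
      | zero => rw [zero_mul]; exact zero_mem _
      | add x y _ _ hx hy => rw [add_mul]; exact add_mem hx hy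
    | zero => rw [mul_zero]; exact zero_mem _
    | add x y _ _ hx hy => rw [mul_add]; exact add_mem hx hy
    | neg x _ hx => rw [mul_neg]; exact neg_mem hx
  have hr : ∀ {a b}, a ∈ K → a * b ∈ K := by
    intro a b ha
    induction ha using AddSubgroup.closure_induction with
    | mem a ha =>
      obtain ⟨n, ha, haJ⟩ := ha
      induction htop b using AddSubmonoid.closure_induction with
      | mem b hb =>
        obtain ⟨m, hb⟩ := hb
        exact AddSubgroup.subset_closure ⟨_, hmul _ _ _ _ ha hb, J.mul_mem_right _ _ haJ⟩
      | zero => rw [mul_zero]; exact zero_mem _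
      | add x y _ _ hx hy => rw [mul_add]; exact add_mem hx hy
    | zero => rw [zero_mul]; exact zero_mem _
    | add x y _ _ hx hy => rw [add_mul]; exact add_mem hx hy
    | neg x _ hx => rw [neg_mul]; exact neg_mem hx
  have hJK : J ≤ TwoSidedIdeal.mk' K (zero_mem K) (fun h h' => add_mem h h')
      (fun h => neg_mem h) hl hr := by
    rw [TwoSidedIdeal.span_le]
    intro a ha
    rw [SetLike.mem_coe, TwoSidedIdeal.mem_mk']
    obtain ⟨n, hn⟩ := hs a ha
    exact AddSubgroup.subset_closure ⟨n, hn, TwoSidedIdeal.subset_span ha⟩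
  intro a ha
  have haK : a ∈ K := by
    have := hJK ha
    rwa [TwoSidedIdeal.mem_mk'] at this
  clear ha
  classical
  induction haK using AddSubgroup.closure_induction with
  | mem a ha =>
    obtain ⟨n, ha, haJ⟩ := ha
    refine ⟨Finsupp.single n a, fun k => ?_, by simp⟩
    rw [Finsupp.single_apply]
    split_ifs with h
    · subst h; exact ⟨ha, haJ⟩
    · exact ⟨zero_mem _, zero_mem _⟩
  | zero => exact ⟨0, fun _ => ⟨zero_mem _, zero_mem _⟩, by simp⟩
  | add x y _ _ hx hy =>
    obtain ⟨f, hf, rfl⟩ := hx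
    obtain ⟨g, hg, rfl⟩ := hy
    exact ⟨f + g, fun n => ⟨add_mem (hf n).1 (hg n).1, add_mem (hf n).2 (hg n).2⟩,
      Finsupp.sum_add_index' (fun _ => rfl) fun _ _ _ => rfl⟩
  | neg x _ hx =>
    obtain ⟨f, hf, rfl⟩ := hx
    refine ⟨-f, fun n => ⟨hneg n _ (hf n).1, neg_mem (hf n).2⟩, ?_⟩
    rw [Finsupp.sum_neg_index fun _ => rfl, Finsupp.sum, Finsupp.sum, Finset.sum_neg_distrib]

namespace LeavittPathAlgebra

/-! ### Ideals of a Leavitt path algebra -/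

/-- The identities `r(e) = e* s(e) e` and `x = ∑ e r(e) e*` give the two directions. -/
theorem isHereditarySaturated_of_ideal (hG : G.RowFinite)
    (I : TwoSidedIdeal (G.LeavittPathAlgebra F)) :
    G.IsHereditarySaturated {x | gen F G (.vert x) ∈ I} := by
  intro x hne
  constructor
  · rintro hx e rfl
    have h : gen F G (.vert (G.r e)) =
        gen F G (.ghost e) * gen F G (.vert (G.s e)) * gen F G (.edge e) := by
      refine Subtype.ext ?_
      change vert F G _ = ghost F G e * vert F G _ * edge F G e
      rw [ghost_mul_source, ghost_mul_edge_self]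
    rw [Set.mem_ofPred_eq, h]
    exact I.mul_mem_right _ _ (I.mul_mem_left _ _ hx)
  · intro h
    have hx : gen F G (.vert x) = ∑ e ∈ (hG x).toFinset,
        gen F G (.edge e) * gen F G (.vert (G.r e)) * gen F G (.ghost e) := by
      refine Subtype.ext ?_
      rw [AddSubmonoidClass.coe_finsetSum]
      change vert F G x = ∑ e ∈ (hG x).toFinset, edge F G e * vert F G _ * ghost F G e
      rw [vert_eq_sum x (hG x) hne]
      exact Finset.sum_congr rfl fun e _ => by rw [edge_mul_range]
    rw [Set.mem_ofPred_eq, hx]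
    exact sum_mem fun e he =>
      I.mul_mem_right _ _ (I.mul_mem_left _ _ (h e (by simpa using he)))

theorem eq_top_of_vert_mem {I : TwoSidedIdeal (G.LeavittPathAlgebra F)}
    (h : ∀ x, gen F G (.vert x) ∈ I) : I = ⊤ := by
  rw [eq_top_iff]
  rintro ⟨a, ha⟩ -
  -- A two-sided ideal is only a ring ideal, so closure under scalars is built into the induction.
  suffices hc : ∀ c : F, c • (⟨a, ha⟩ : G.LeavittPathAlgebra F) ∈ I by simpa using hc 1
  induction ha using NonUnitalAlgebra.adjoin_induction with
  | mem a ha =>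
    obtain ⟨g, rfl⟩ := ha
    intro c
    obtain ⟨x, hx⟩ : ∃ x, vert F G x * LeavittUnitization.gen F G g =
        LeavittUnitization.gen F G g := by
      rcases g with x | e | e
      · exact ⟨x, vert_mul_self x⟩
      · exact ⟨_, source_mul_edge e⟩
      · exact ⟨_, range_mul_ghost e⟩
    have h1 : c • gen F G g = gen F G (.vert x) * (c • gen F G g) := by
      rw [mul_smul_comm]
      congr 1
      exact Subtype.ext hx.symm
    change c • gen F G g ∈ I
    rw [h1]
    exact I.mul_mem_right _ _ (h x)
  | zero =>
    intro c
    have : c • (⟨0, zero_mem _⟩ : G.LeavittPathAlgebra F) = 0 := smul_zero c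
    rw [this]
    exact zero_mem _
  | add a b ha hb iha ihb =>
    intro c
    have : c • (⟨a + b, add_mem ha hb⟩ : G.LeavittPathAlgebra F) = c • ⟨a, ha⟩ + c • ⟨b, hb⟩ :=
      smul_add c (⟨a, ha⟩ : G.LeavittPathAlgebra F) ⟨b, hb⟩
    rw [this]
    exact add_mem (iha c) (ihb c)
  | mul a b ha hb iha ihb =>
    intro c
    have : c • (⟨a * b, mul_mem ha hb⟩ : G.LeavittPathAlgebra F) = (c • ⟨a, ha⟩) * ⟨b, hb⟩ :=
      (smul_mul_assoc c (⟨a, ha⟩ : G.LeavittPathAlgebra F) ⟨b, hb⟩).symm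
    rw [this]
    exact I.mul_mem_right _ _ (iha c)
  | smul d a ha iha =>
    intro c
    have := iha (c * d)
    rw [mul_smul] at this
    exact this

theorem mul_mem_component {m n : ℤ} {a b : G.LeavittPathAlgebra F} (ha : a ∈ component F G m)
    (hb : b ∈ component F G n) : a * b ∈ component F G (m + n) := by
  induction ha using Submodule.span_induction with
  | mem a ha =>
    induction hb using Submodule.span_induction with
    | mem b hb => exact Submodule.subset_span (IsMonomial.mul ha hb)
    | zero => rw [mul_zero]; exact zero_mem _
    | add x y _ _ hx hy => rw [mul_add]; exact add_mem hx hy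
    | smul c x _ hx => rw [mul_smul_comm]; exact Submodule.smul_mem _ c hx
  | zero => rw [zero_mul]; exact zero_mem _
  | add x y _ _ hx hy => rw [add_mul]; exact add_mem hx hy
  | smul c x _ hx => rw [smul_mul_assoc]; exact Submodule.smul_mem _ c hx

theorem gen_mem_component (g : LGen V E) : gen F G g ∈ component F G g.deg :=
  Submodule.subset_span (IsMonomial.gen g)

theorem mem_iSup_component (a : G.LeavittPathAlgebra F) : a ∈ ⨆ n, component F G n := by
  obtain ⟨a, ha⟩ := a
  induction ha using NonUnitalAlgebra.adjoin_induction with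
  | mem a ha =>
    obtain ⟨g, rfl⟩ := ha
    exact Submodule.mem_iSup_of_mem _ (gen_mem_component g)
  | zero => exact zero_mem (⨆ n, component F G n)
  | add a b ha hb iha ihb => exact add_mem iha ihb
  | mul a b ha hb iha ihb =>
    change (⟨a, ha⟩ * ⟨b, hb⟩ : G.LeavittPathAlgebra F) ∈ _
    generalize (⟨a, ha⟩ : G.LeavittPathAlgebra F) = a at iha
    generalize (⟨b, hb⟩ : G.LeavittPathAlgebra F) = b at ihb
    induction iha using Submodule.iSup_induction' with
    | mem m a ha =>
      induction ihb using Submodule.iSup_induction' with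
      | mem n b hb => exact Submodule.mem_iSup_of_mem _ (mul_mem_component ha hb)
      | zero => rw [mul_zero]; exact zero_mem _
      | add x y _ _ hx hy => rw [mul_add]; exact add_mem hx hy
    | zero => rw [zero_mul]; exact zero_mem _
    | add x y _ _ hx hy => rw [add_mul]; exact add_mem hx hy
  | smul c a ha iha => exact Submodule.smul_mem _ c iha

/-- An ideal generated by vertices is graded. -/
theorem isGradedIdeal_span (H : Set V) :
    IsGradedIdeal (component F G) (TwoSidedIdeal.span ((fun x => gen F G (.vert x)) '' H)) := by
  refine isGradedIdeal_span_of_homogeneous (A := component F G) (fun n a ha => ?_)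
    (fun m n a b ha hb => ?_) (fun a => ?_) ?_
  · have h : -a = (-1 : F) • a := Subtype.ext (by
      exact (neg_one_smul F (a : LeavittUnitization F G)).symm)
    rw [h]
    exact Submodule.smul_mem _ _ ha
  · exact mul_mem_component ha hb
  · induction mem_iSup_component a using Submodule.iSup_induction' with
    | mem n a ha => exact AddSubmonoid.subset_closure ⟨n, ha⟩
    | zero => exact zero_mem _
    | add x y _ _ hx hy => exact add_mem hx hy
  · rintro _ ⟨x, -, rfl⟩
    exact ⟨_, gen_mem_component _⟩

/-- For the forward direction, the graded ideal generated by `H` is squeezed by a representation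
that kills no vertex outside `H`. For the converse, a nonzero homogeneous element of the ideal has a
vertex among its multiples. -/
theorem isGradedSimple_iff [Nonempty V] (hG : G.RowFinite) :
    IsGradedSimple (component F G) ↔
      ∀ H : Set V, G.IsHereditarySaturated H → H = ∅ ∨ H = Set.univ := by
  constructor
  · rintro ⟨-, h⟩ H hH
    obtain ⟨B, hB⟩ := exists_branchingSystem hG hH
    rcases h _ (isGradedIdeal_span (F := F) (G := G) H) with h0 | h1
    · left
      ext x
      simp only [Set.mem_empty_iff_false, iff_false]
      intro hx
      have : gen F G (.vert x) ∈ TwoSidedIdeal.span ((fun x => gen F G (.vert x)) '' H) :=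
        TwoSidedIdeal.subset_span ⟨x, hx, rfl⟩
      rw [h0] at this
      exact vert_ne_zero hG x (by simpa using this)
    · right
      ext x
      simp only [Set.mem_univ, iff_true]
      have hle : TwoSidedIdeal.span ((fun x => gen F G (.vert x)) '' H) ≤ B.kerIdeal F := by
        rw [TwoSidedIdeal.span_le]
        rintro _ ⟨y, hy, rfl⟩
        exact B.vert_mem_kerIdeal.2 ((hB y).1 hy)
      rw [hB, ← B.vert_mem_kerIdeal (F := F)]
      apply hle
      rw [h1]
      trivial
  · intro h
    obtain ⟨x₀⟩ := ‹Nonempty V›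
    refine ⟨⟨_, _, vert_ne_zero hG x₀⟩, fun I hI => ?_⟩
    by_contra! hc
    obtain ⟨a, ha, ha0⟩ : ∃ a ∈ I, a ≠ 0 := by
      by_contra! h0
      exact hc.1 (eq_bot_iff.2 fun a ha => by simpa using h0 a ha)
    obtain ⟨f, hf, rfl⟩ := hI a ha
    obtain ⟨n, hn⟩ : ∃ n, f n ≠ 0 := by
      by_contra! h0
      exact ha0 (Finset.sum_eq_zero fun n _ => h0 n)
    obtain ⟨b, d, x, hx⟩ := exists_mul_mul_eq_vert_of_mem_component hG (hf n).1 hn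
    have hxI : gen F G (.vert x) ∈ I := by
      rw [← hx]
      exact I.mul_mem_right _ _ (I.mul_mem_left _ _ (hf n).2)
    rcases h _ (isHereditarySaturated_of_ideal hG I) with h0 | h1
    · have : x ∈ {x | gen F G (.vert x) ∈ I} := hxI
      rw [h0] at this
      exact this
    · refine hc.2 (eq_top_of_vert_mem fun y => ?_)
      have : y ∈ {x | gen F G (.vert x) ∈ I} := by rw [h1]; trivial
      exact this

/-- As in the graded case, with (L) replacing homogeneity in the reduction to a vertex. -/
theorem isSimpleRing_iff [Nonempty V] (hG : G.RowFinite) :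
    IsSimpleRing (G.LeavittPathAlgebra F) ↔
      (∀ H : Set V, G.IsHereditarySaturated H → H = ∅ ∨ H = Set.univ) ∧
        G.ClosedPathsHaveExits := by
  constructor
  · intro h
    refine ⟨(isGradedSimple_iff (F := F) hG).1 ⟨?_, fun I _ => h.simple.eq_bot_or_eq_top I⟩,
      closedPathsHaveExits_of_isSimpleRing h⟩
    obtain ⟨x₀⟩ := ‹Nonempty V›
    exact ⟨_, _, vert_ne_zero hG x₀⟩
  · rintro ⟨h, hL⟩
    obtain ⟨x₀⟩ := ‹Nonempty V›
    refine ⟨{ exists_pair_ne := ⟨⊥, ⊤, fun h0 => ?_⟩, eq_bot_or_eq_top := fun I => ?_ }⟩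
    · have : gen F G (.vert x₀) ∈ (⊥ : TwoSidedIdeal (G.LeavittPathAlgebra F)) := by
        rw [h0]; trivial
      exact vert_ne_zero hG x₀ (by simpa using this)
    · by_contra! hc
      obtain ⟨a, ha, ha0⟩ : ∃ a ∈ I, a ≠ 0 := by
        by_contra! h0
        exact hc.1 (eq_bot_iff.2 fun a ha => by simpa using h0 a ha)
      obtain ⟨b, d, x, hx⟩ := exists_mul_mul_eq_vert hG hL ha0
      have hxI : gen F G (.vert x) ∈ I := by
        rw [← hx]
        exact I.mul_mem_right _ _ (I.mul_mem_left _ _ ha)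
      rcases h _ (isHereditarySaturated_of_ideal hG I) with h0 | h1
      · have : x ∈ {x | gen F G (.vert x) ∈ I} := hxI
        rw [h0] at this
        exact this
      · refine hc.2 (eq_top_of_vert_mem fun y => ?_)
        have : y ∈ {x | gen F G (.vert x) ∈ I} := by rw [h1]; trivial
        exact this

end LeavittPathAlgebra

end DirGraph

/-! ### Infinite idempotents -/

section InfiniteIdempotents

variable {R : Type*} [NonUnitalRing R]

/-- An idempotent above an idempotent `p` with `p = b a`, `a b ≠ p` is infinite. -/
theorem isInfiniteIdempotent_of_corner {v p a b : R} (hv : v * v = v) (hp : p * p = p)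
    (hvp : v * p = p) (hpv : p * v = p) (hba : b * a = p) (hpa : p * a = a) (hap : a * p = a)
    (hpb : p * b = b) (hbp : b * p = b) (hne : a * b ≠ p) : IsInfiniteIdempotent v := by
  have hva : v * a = a := by rw [← hpa, ← mul_assoc, hvp]
  have hbv : b * v = b := by rw [← hbp, mul_assoc, hpv]
  have hav : a * v = a := by rw [← hap, mul_assoc, hpv]
  have hvb : v * b = b := by rw [← hpb, ← mul_assoc, hvp]
  have hva' : ∀ z, v * (a * z) = a * z := fun z => by rw [← mul_assoc, hva]
  have hpa' : ∀ z, p * (a * z) = a * z := fun z => by rw [← mul_assoc, hpa]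
  have hba' : ∀ z, b * (a * z) = p * z := fun z => by rw [← mul_assoc, hba]
  -- Both `a` and `b` are extended by the identity on the complement `v - p`, so that `b a = p`
  -- becomes the product `v`.
  refine ⟨hv, v - p + a * b, p - a * b, ?_, ?_, ?_, ?_, by abel,
    sub_ne_zero.2 hne.symm, b + (v - p), a + (v - p), ?_, ?_⟩
  all_goals
    simp only [IsIdempotentElem, mul_add, add_mul, mul_sub, sub_mul, mul_assoc, hv, hp, hvp, hpv,
      hba, hpa, hap, hpb, hbp, hva, hbv, hav, hvb, hva', hpa', hba']
    abel

/-- A right ideal that contains an element `a` with `x a y` an infinite idempotent contains an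
infinite idempotent. -/
theorem exists_isInfiniteIdempotent_mem {J : AddSubgroup R} (hJ : ∀ a ∈ J, ∀ b : R, a * b ∈ J)
    {a x y v : R} (ha : a ∈ J) (hv : IsInfiniteIdempotent v) (h : x * a * y = v) :
    ∃ e ∈ J, IsInfiniteIdempotent e := by
  obtain ⟨hvv, f, g, hf, hg, hfg, hgf, hvfg, hg0, s, t, hst, hts⟩ := hv
  unfold IsIdempotentElem at hvv hf hg
  have hvf : v * f = f := by rw [hvfg, add_mul, hf, hgf, add_zero]
  have hfv : f * v = f := by rw [hvfg, mul_add, hf, hfg, add_zero]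
  have hvg : v * g = g := by rw [hvfg, add_mul, hg, hfg, zero_add]
  have hgv : g * v = g := by rw [hvfg, mul_add, hg, hgf, zero_add]
  set A := a * y * v with hA
  set B := v * x with hB
  have hBA : B * A = v := by
    calc v * x * (a * y * v) = v * (x * a * y) * v := by simp only [mul_assoc]
      _ = v := by rw [h, hvv, hvv]
  have hAv : A * v = A := by rw [hA, mul_assoc, hvv]
  have hvB : v * B = B := by rw [hB, ← mul_assoc, hvv]
  -- As `B * A = v`, the map `c ↦ A * c * B` is multiplicative on the corner of `v`; its values lie
  -- in `J` because `a ∈ J`. It transports the whole decomposition of `v`.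
  have key : ∀ c d : R, A * c * B * (A * d * B) = A * (c * v * d) * B := fun c d => by
    rw [← hBA]; simp only [mul_assoc]
  have hABJ : ∀ c, A * c ∈ J := fun c => by
    rw [hA, mul_assoc, mul_assoc]
    exact hJ a ha _
  refine ⟨A * v * B, by rw [mul_assoc]; exact hABJ _, ?_, A * f * B, A * g * B, ?_, ?_, ?_, ?_, ?_,
    ?_, A * (v * s * f) * B, A * (f * t * v) * B, ?_, ?_⟩
  · rw [IsIdempotentElem, key, hvv, hvv]
  · rw [IsIdempotentElem, key, hfv, hf]
  · rw [IsIdempotentElem, key, hgv, hg]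
  · rw [key, hfv, hfg, mul_zero, zero_mul]
  · rw [key, hgv, hgf, mul_zero, zero_mul]
  · rw [hvfg, mul_add, add_mul]
  · intro h0
    apply hg0
    have h1 : B * (A * g * B) * A = v * g * v := by rw [← hBA]; simp only [mul_assoc]
    rw [h0, mul_zero, zero_mul, hvg, hgv] at h1
    exact h1.symm
  · rw [key]
    congr 2
    calc v * s * f * v * (f * t * v) = v * s * (f * v * f) * t * v := by simp only [mul_assoc]
      _ = v * (s * t) * (s * t) * v := by rw [hfv, hf, ← hts]; simp only [mul_assoc]
      _ = v := by rw [hst, hvv, hvv, hvv]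
  · rw [key]
    congr 2
    calc f * t * v * v * (v * s * f) = f * t * (v * v * v) * s * f := by simp only [mul_assoc]
      _ = f * (t * s) * (t * s) * f := by rw [hvv, hvv, ← hst]; simp only [mul_assoc]
      _ = f := by rw [hts, hf, hf, hf]

/-- A finite-dimensional subalgebra contains no infinite idempotent decomposition. -/
theorem eq_zero_of_mem_finiteDimensional {F U : Type*} [Field F] [Ring U] [Algebra F U]
    (S : NonUnitalSubalgebra F U) [FiniteDimensional F S.toSubmodule] {e f g x y : U}
    (he : e ∈ S) (hf : f ∈ S) (hg : g ∈ S) (hx : x ∈ S) (hy : y ∈ S) (hff : f * f = f)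
    (hgg : g * g = g) (hfg : f * g = 0) (hgf : g * f = 0) (hefg : e = f + g)
    (hxy : x * y = e) (hyx : y * x = f) : g = 0 := by
  have hee : e * e = e := by rw [hefg, add_mul, mul_add, mul_add, hff, hgg, hfg, hgf]; simp
  have hef : e * f = f := by rw [hefg, add_mul, hff, hgf, add_zero]
  have hfe : f * e = f := by rw [hefg, mul_add, hff, hfg, add_zero]
  set X := e * x * f + (1 - e) with hX
  set Y := f * y * e + (1 - e) with hY
  have h1 : e * x * f * (f * y * e) = e := by
    calc e * x * f * (f * y * e) = e * x * (f * f) * y * e := by simp only [mul_assoc]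
      _ = e * (x * y) * (x * y) * e := by rw [hff, ← hyx]; simp only [mul_assoc]
      _ = e := by rw [hxy, hee, hee, hee]
  have h2 : f * y * e * (e * x * f) = f := by
    calc f * y * e * (e * x * f) = f * y * (e * e) * x * f := by simp only [mul_assoc]
      _ = f * (y * x) * (y * x) * f := by rw [hee, ← hxy]; simp only [mul_assoc]
      _ = f := by rw [hyx, hff, hff, hff]
  have hXY : X * Y = 1 := by
    have h3 : e * x * f * (1 - e) = 0 := by rw [mul_sub, mul_one, mul_assoc _ f e, hfe, sub_self]
    have h4 : (1 - e) * (f * y * e) = 0 := by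
      rw [sub_mul, one_mul, ← mul_assoc e, ← mul_assoc e, hef, sub_self]
    have h5 : (1 - e) * (1 - e) = 1 - e := by
      rw [mul_sub, mul_one, sub_mul, one_mul, hee, sub_self, sub_zero]
    rw [hX, hY, add_mul, mul_add, mul_add, h1, h3, h4, h5]
    abel
  have hYX : Y * X = f + (1 - e) := by
    have h3 : f * y * e * (1 - e) = 0 := by rw [mul_sub, mul_one, mul_assoc _ e e, hee, sub_self]
    have h4 : (1 - e) * (e * x * f) = 0 := by
      rw [sub_mul, one_mul, ← mul_assoc e, ← mul_assoc e, hee, sub_self]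
    have h5 : (1 - e) * (1 - e) = 1 - e := by
      rw [mul_sub, mul_one, sub_mul, one_mul, hee, sub_self, sub_zero]
    rw [hX, hY, add_mul, mul_add, mul_add, h2, h3, h4, h5]
    abel
  have hXS : ∀ b ∈ S.toSubmodule, LinearMap.mulRight F X b ∈ S.toSubmodule := fun b hb => by
    change b * X ∈ S
    rw [hX, mul_add, mul_sub, mul_one]
    exact add_mem (mul_mem hb (mul_mem (mul_mem he hx) hf)) (sub_mem hb (mul_mem hb he))
  have hYS : ∀ b ∈ S.toSubmodule, LinearMap.mulRight F Y b ∈ S.toSubmodule := fun b hb => by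
    change b * Y ∈ S
    rw [hY, mul_add, mul_sub, mul_one]
    exact add_mem (mul_mem hb (mul_mem (mul_mem hf hy) he)) (sub_mem hb (mul_mem hb he))
  have h6 : (LinearMap.mulRight F Y).restrict hYS * (LinearMap.mulRight F X).restrict hXS = 1 := by
    ext b
    change b.1 * X * Y = b.1
    rw [mul_assoc, hXY, mul_one]
  rw [mul_eq_one_comm] at h6
  have h7 : g * Y * X = g :=
    congrArg Subtype.val (DFunLike.congr_fun h6 (⟨g, hg⟩ : S.toSubmodule))
  rw [← h7, mul_assoc, hYX, hefg, mul_add, mul_sub, mul_add, hgf, hgg]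
  simp

end InfiniteIdempotents

/-! ### Pure infiniteness, closed paths and acyclic graphs -/

namespace DirGraph

variable {V : Type u} {E : Type v} {F : Type w} [Field F] {G : DirGraph V E}

open LeavittUnitization

/-- The vertex `x` connects to a closed path of positive length. -/
def ReachesClosedPath (G : DirGraph V E) (x : V) : Prop :=
  ∃ y p t, G.IsPath x y p ∧ G.IsPath y y t ∧ t ≠ []

theorem isHereditarySaturated_not_reachesClosedPath :
    G.IsHereditarySaturated {x | ¬G.ReachesClosedPath x} := by
  rintro x ⟨e₀, he₀⟩
  constructor
  · rintro hx e rfl ⟨y, p, t, hp, ht, hne⟩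
    exact hx ⟨y, e :: p, t, hp.cons, ht, hne⟩
  · rintro h ⟨y, p, t, hp, ht, hne⟩
    cases hp with
    | nil =>
      cases ht with
      | nil => exact hne rfl
      -- The closed path is based at `x` itself: the range of its first edge returns to `x` along
      -- the rest.
      | @cons e _ q hq => exact h e rfl ⟨_, q, e :: q, hq, hq.cons, by simp⟩
    | @cons e _ p hp => exact h e rfl ⟨y, p, t, hp, ht, hne⟩

theorem reachesClosedPath_of_exists
    (h : ∀ H : Set V, G.IsHereditarySaturated H → H = ∅ ∨ H = Set.univ)
    (hex : ∃ x t, G.IsPath x x t ∧ t ≠ []) (x : V) : G.ReachesClosedPath x := by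
  rcases h _ isHereditarySaturated_not_reachesClosedPath with h0 | h1
  · by_contra hx
    have : x ∈ {x | ¬G.ReachesClosedPath x} := hx
    rw [h0] at this
    exact this
  · obtain ⟨y, t, ht, hne⟩ := hex
    have : y ∈ {x | ¬G.ReachesClosedPath x} := by rw [h1]; trivial
    exact absurd ⟨y, [], t, .nil y, ht, hne⟩ this

namespace LeavittPathAlgebra

/-- For the closed path `t` at `y`, `t* t = y` while `t t* ≠ y` because of the exit. Conjugation by
the path `p` moves this into the subidempotent `p p*` of `x`. -/
theorem isInfiniteIdempotent_vert (hG : G.RowFinite) (hL : G.ClosedPathsHaveExits) {x : V}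
    (hx : G.ReachesClosedPath x) : IsInfiniteIdempotent (gen F G (.vert x)) := by
  obtain ⟨y, p, t, hp, ht, hne⟩ := hx
  let P : LeavittPathAlgebra F G := ⟨_, pathElt_mem hp⟩
  let Q : LeavittPathAlgebra F G := ⟨_, ghostElt_mem hp⟩
  let C : LeavittPathAlgebra F G := ⟨_, pathElt_mem ht⟩
  let D : LeavittPathAlgebra F G := ⟨_, ghostElt_mem ht⟩
  let v : LeavittPathAlgebra F G := gen F G (.vert x)
  let w : LeavittPathAlgebra F G := gen F G (.vert y)
  have hv : v * v = v := Subtype.ext (vert_mul_self x)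
  have hQP : Q * P = w := Subtype.ext <| by
    change vert F G y * ghostElt F G p * (pathElt F G p * vert F G y) = vert F G y
    rw [mul_assoc, ghostElt_mul_pathElt hp, vert_mul_self]
  have hDC : D * C = w := Subtype.ext <| by
    change vert F G y * ghostElt F G t * (pathElt F G t * vert F G y) = vert F G y
    rw [mul_assoc, ghostElt_mul_pathElt ht, vert_mul_self]
  have hvP : v * P = P := Subtype.ext (vert_mul_pathElt hp)
  have hQv : Q * v = Q := Subtype.ext (ghostElt_mul_vert hp)
  have hwC : w * C = C := Subtype.ext (vert_mul_pathElt ht)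
  have hDw : D * w = D := Subtype.ext (ghostElt_mul_vert ht)
  have hPw : P * w = P := Subtype.ext <| by
    change pathElt F G p * vert F G y * vert F G y = pathElt F G p * vert F G y
    rw [mul_assoc, vert_mul_self]
  have hCw : C * w = C := Subtype.ext <| by
    change pathElt F G t * vert F G y * vert F G y = pathElt F G t * vert F G y
    rw [mul_assoc, vert_mul_self]
  have hwD : w * D = D := Subtype.ext <| by
    change vert F G y * (vert F G y * ghostElt F G t) = vert F G y * ghostElt F G t
    rw [← mul_assoc, vert_mul_self]
  have key : ∀ c d : LeavittPathAlgebra F G, P * c * Q * (P * d * Q) = P * (c * w * d) * Q :=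
    fun c d => by rw [← hQP]; simp only [mul_assoc]
  have hww : w * w = w := Subtype.ext (vert_mul_self y)
  refine isInfiniteIdempotent_of_corner (p := P * w * Q) (a := P * C * Q) (b := P * D * Q) hv
    ?_ ?_ ?_ ?_ ?_ ?_ ?_ ?_ ?_
  · rw [key, hww, hww]
  · change v * _ = _
    rw [← mul_assoc, ← mul_assoc, hvP]
  · change _ * v = _
    rw [mul_assoc, hQv]
  · rw [key, hDw, hDC]
  · rw [key, hww, hwC]
  · rw [key, hCw, hCw]
  · rw [key, hww, hwD]
  · rw [key, hDw, hDw]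
  · rw [key, hCw]
    intro h
    have hCD : C * D = w := by
      have h1 : Q * (P * (C * D) * Q) * P = w * (C * D) * w := by
        rw [← hQP]; simp only [mul_assoc]
      have h2 : Q * (P * w * Q) * P = w * w * w := by
        calc _ = Q * P * w * (Q * P) := by simp only [mul_assoc]
          _ = _ := by rw [hQP]
      rw [h, h2, hww, hww, ← mul_assoc, hwC, mul_assoc, hDw] at h1
      exact h1.symm
    obtain ⟨e, he, f, hfe, hs⟩ := hL y t ht hne
    obtain ⟨α, β, rfl⟩ := List.append_of_mem he
    obtain ⟨z, hα, hβ⟩ := IsPath.append_iff.1 ht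
    obtain ⟨rfl, hβ⟩ := IsPath.cons_iff.1 hβ
    have hγ : G.IsPath y (G.r f) (α ++ [f]) := hα.append (by rw [← hs]; exact .single f)
    -- If `t t* = y`, then the path `α f` equals `t t* α f`, which is zero since `t` and `α f`
    -- diverge. Then the vertex `r f` would vanish.
    have h1 : vert F G y * (pathElt F G (α ++ [f]) * vert F G (G.r f)) = 0 := by
      have h2 : pathElt F G (α ++ e :: β) * vert F G y *
          (vert F G y * ghostElt F G (α ++ e :: β)) = vert F G y := congrArg Subtype.val hCD
      rw [← h2, mul_assoc, mul_assoc (vert F G y), ← mul_assoc (ghostElt F G _),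
        ghostElt_mul_pathElt_of_diverge β [] (by rw [hs]; exact hα) hfe.symm]
      simp
    rw [vert_mul_pathElt hγ] at h1
    have h3 := ghostElt_mul_pathElt (F := F) hγ
    rw [h1, mul_zero] at h3
    exact vert_ne_zero (F := F) hG (G.r f) (Subtype.ext h3.symm)

/-- The Leavitt path algebra of an acyclic graph has no infinite idempotents. -/
theorem not_isInfiniteIdempotent_of_acyclic (hac : ∀ x p, G.IsPath x x p → p = [])
    (e : LeavittPathAlgebra F G) : ¬IsInfiniteIdempotent e := by
  classical
  rintro ⟨-, f, g, hff, hgg, hfg, hgf, hefg, hg0, x, y, hxy, hyx⟩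
  have hsub : ∀ {s t : Set (LGen V E)}, s ⊆ t →
      NonUnitalAlgebra.adjoin F (LeavittUnitization.gen F G '' s) ≤
        NonUnitalAlgebra.adjoin F (LeavittUnitization.gen F G '' t) := fun h =>
    NonUnitalAlgebra.adjoin_mono (Set.image_mono h)
  have hfinite : ∀ a : LeavittPathAlgebra F G, ∃ s : Finset (LGen V E),
      (a : LeavittUnitization F G) ∈
        NonUnitalAlgebra.adjoin F (LeavittUnitization.gen F G '' (s : Set (LGen V E))) := by
    rintro ⟨a, ha⟩
    simp only
    induction ha using NonUnitalAlgebra.adjoin_induction with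
    | mem a ha =>
      obtain ⟨g, rfl⟩ := ha
      exact ⟨{g}, NonUnitalAlgebra.subset_adjoin F ⟨g, by simp, rfl⟩⟩
    | zero => exact ⟨∅, zero_mem _⟩
    | add a b _ _ iha ihb =>
      obtain ⟨s, hs⟩ := iha
      obtain ⟨t, ht⟩ := ihb
      exact ⟨s ∪ t, add_mem (hsub (by simp) hs) (hsub (by simp) ht)⟩
    | mul a b _ _ iha ihb =>
      obtain ⟨s, hs⟩ := iha
      obtain ⟨t, ht⟩ := ihb
      exact ⟨s ∪ t, mul_mem (hsub (by simp) hs) (hsub (by simp) ht)⟩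
    | smul c a _ iha =>
      obtain ⟨s, hs⟩ := iha
      exact ⟨s, Submodule.smul_mem (NonUnitalAlgebra.adjoin F
        (LeavittUnitization.gen F G '' (s : Set (LGen V E)))).toSubmodule c hs⟩
  choose s hs using hfinite
  let t : Finset (LGen V E) := s e ∪ s f ∪ s g ∪ s x ∪ s y
  let A : Set E := {a | .edge a ∈ t ∨ .ghost a ∈ t}
  -- The ranges are added so that monomials over `A` and `W` span the subalgebra.
  let W : Set V := {a | .vert a ∈ t} ∪ G.r '' A
  have hA : A.Finite := by
    have h1 : {a : E | (LGen.edge a : LGen V E) ∈ t}.Finite :=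
      t.finite_toSet.preimage fun a _ b _ h => by injection h
    have h2 : {a : E | (LGen.ghost a : LGen V E) ∈ t}.Finite :=
      t.finite_toSet.preimage fun a _ b _ h => by injection h
    exact h1.union h2
  have hW : W.Finite := by
    have h1 : {a : V | (LGen.vert a : LGen V E) ∈ t}.Finite :=
      t.finite_toSet.preimage fun a _ b _ h => by injection h
    exact h1.union (hA.image _)
  have hrA : ∀ a ∈ A, G.r a ∈ W := fun a ha => .inr ⟨a, ha, rfl⟩
  let S := NonUnitalAlgebra.adjoin F (LeavittUnitization.gen F G '' {g | g.Supported A W})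
  have htS : ∀ a : LeavittPathAlgebra F G, s a ⊆ t → (a : LeavittUnitization F G) ∈ S := by
    intro a ha
    refine hsub ?_ (hs a)
    rintro (z | z | z) hz
    · exact .inl (ha hz)
    · exact .inl (ha hz)
    · exact .inr (ha hz)
  have hpaths : {p : List E | p.Nodup ∧ ∀ a ∈ p, a ∈ A}.Finite := by
    have := hA.to_subtype
    have := Fintype.ofFinite A
    refine ((List.finite_length_le A (Fintype.card A)).image (List.map Subtype.val)).subset ?_
    rintro p ⟨hnd, hpA⟩
    lift p to List A using hpA
    exact ⟨p, (List.Nodup.of_map _ hnd).length_le_card, rfl⟩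
  -- A repeated edge would give a closed path. So only finitely many paths use edges of the finite
  -- set `A`, and finitely many monomials span `S`.
  have hnodup : ∀ {x y p}, G.IsPath x y p → p.Nodup := by
    intro x y p hp
    induction hp with
    | nil => exact List.nodup_nil
    | @cons a y p hp ih =>
      refine List.nodup_cons.2 ⟨fun ha => ?_, ih⟩
      obtain ⟨α, β, rfl⟩ := List.append_of_mem ha
      obtain ⟨z, hα, hβ⟩ := IsPath.append_iff.1 hp
      obtain ⟨rfl, -⟩ := IsPath.cons_iff.1 hβ
      exact absurd (hac _ _ hα.cons) (by simp)
  have hmon : (⋃ n, monomials F G A W n).Finite := by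
    refine ((hpaths.prod (hpaths.prod hW)).image fun q =>
      pathElt F G q.1 * (vert F G q.2.2 * ghostElt F G q.2.1)).subset ?_
    rintro a ha
    obtain ⟨n, p, q, x, y, z, hp, hq, hpA, hqA, hz, -, rfl⟩ := Set.mem_iUnion.1 ha
    exact ⟨(p, q, z), ⟨⟨hnodup hp, hpA⟩, ⟨hnodup hq, hqA⟩, hz⟩, rfl⟩
  have hfd : FiniteDimensional F S.toSubmodule := by
    have : FiniteDimensional F (Submodule.span F (⋃ n, monomials F G A W n)) :=
      FiniteDimensional.span_of_finite F hmon
    exact Submodule.finiteDimensional_of_le fun a ha => adjoin_le_span_monomials hrA ha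
  have hse : s e ⊆ t := fun a ha => by simp [t, ha]
  have hsf : s f ⊆ t := fun a ha => by simp [t, ha]
  have hsg : s g ⊆ t := fun a ha => by simp [t, ha]
  have hsx : s x ⊆ t := fun a ha => by simp [t, ha]
  have hsy : s y ⊆ t := fun a ha => by simp [t, ha]
  exact hg0 (Subtype.ext (eq_zero_of_mem_finiteDimensional S (htS e hse) (htS f hsf) (htS g hsg)
    (htS x hsx) (htS y hsy) (congrArg Subtype.val hff) (congrArg Subtype.val hgg)
    (congrArg Subtype.val hfg) (congrArg Subtype.val hgf) (congrArg Subtype.val hefg)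
    (congrArg Subtype.val hxy) (congrArg Subtype.val hyx)))

/-- Under (H) and (L), a closed path makes all vertices infinite, and every nonzero right ideal
inherits this through the reduction to a vertex. Without closed paths even the whole ring has no
infinite idempotent. -/
theorem isPurelyInfiniteSimple_iff [Nonempty V] (hG : G.RowFinite) :
    IsPurelyInfiniteSimple (G.LeavittPathAlgebra F) ↔
      (∀ H : Set V, G.IsHereditarySaturated H → H = ∅ ∨ H = Set.univ) ∧
        G.ClosedPathsHaveExits ∧ ∃ x t, G.IsPath x x t ∧ t ≠ [] := by
  unfold IsPurelyInfiniteSimple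
  rw [isSimpleRing_iff hG, and_assoc]
  refine and_congr_right fun hH => and_congr_right fun hL => ?_
  constructor
  · intro h
    by_contra! hac
    obtain ⟨x₀⟩ := ‹Nonempty V›
    obtain ⟨e, -, he⟩ := h ⊤ (fun _ _ _ => trivial) fun h0 => by
      have : gen F G (.vert x₀) ∈ (⊤ : AddSubgroup (G.LeavittPathAlgebra F)) := trivial
      rw [h0, AddSubgroup.mem_bot] at this
      exact vert_ne_zero hG x₀ this
    exact not_isInfiniteIdempotent_of_acyclic hac e he
  · intro hex J hJ hne
    obtain ⟨a, haJ, ha0⟩ := (AddSubgroup.bot_or_exists_ne_zero J).resolve_left hne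
    obtain ⟨b, d, x, hx⟩ := exists_mul_mul_eq_vert hG hL ha0
    exact exists_isInfiniteIdempotent_mem hJ haJ
      (isInfiniteIdempotent_vert hG hL (reachesClosedPath_of_exists hH hex x)) hx

end LeavittPathAlgebra

/-! ### Order conditions on shifts in terms of closed paths -/

namespace GrMonoid

/-- A closed path without exits gives a vertex equal to a negative shift of itself: comparable, but
not strictly. With exits, `not_act_neg_le` rules out the wrong direction and equality at once. -/
theorem algLT_act_neg_iff (hG : G.RowFinite) :
    (∀ a : G.GrMonoid, a ≠ 0 → ∀ n : ℤ, n < 0 →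
        AlgComparable (G.act n a) a → AlgLT a (G.act n a)) ↔ G.ClosedPathsHaveExits := by
  constructor
  · intro h
    by_contra hL
    obtain ⟨x, m, hm, hx⟩ := exists_of_eq_act hG hL
    exact (h (of G x 0) (of_ne_zero x 0) (-m) (by omega) (.inl ⟨0, by rw [← hx, add_zero]⟩)).2 hx
  · intro hL a ha n hn hc
    have h1 := not_act_neg_le hG hL ha hn
    exact ⟨hc.resolve_left h1, fun h => h1 ⟨0, by rw [← h, add_zero]⟩⟩

theorem exists_closedPath_iff (hG : G.RowFinite) (hL : G.ClosedPathsHaveExits) :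
    (∃ x t, G.IsPath x x t ∧ t ≠ []) ↔
      ∃ a : G.GrMonoid, ∃ n : ℤ, n < 0 ∧ AlgLT a (G.act n a) := by
  constructor
  · rintro ⟨x, t, ht, hne⟩
    have hlen : 0 < t.length := List.length_pos_iff.2 hne
    refine ⟨of G x 0, -t.length, by omega, ?_⟩
    refine (algLT_act_neg_iff hG).2 hL _ (of_ne_zero x 0) _ (by omega) (.inr ?_)
    have := of_path_le hG ht (-t.length)
    rw [act_of, zero_add]
    rwa [neg_add_cancel] at this
  · rintro ⟨a, n, hn, hle, hne⟩
    by_contra! hac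
    have h0 := eq_zero_of_le_act_neg hG hac hn hle
    refine hne ?_
    rw [h0]
    exact (map_zero (shift G n)).symm

/-- A closed path without exits gives an element `a` of period `m`. From a ≤ ⁿa one gets a ≤ ⁿa ≤ …
≤ ᵐⁿa = a, so antisymmetry contradicts strictness. -/
theorem closedPathsHaveExits_of_forall_exists (hG : G.RowFinite)
    (h : ∀ a : G.GrMonoid, a ≠ 0 → ∃ n : ℤ, n < 0 ∧ AlgLT a (G.act n a)) :
    G.ClosedPathsHaveExits := by
  by_contra hL
  obtain ⟨x, m, hm, hx⟩ := exists_of_eq_act hG hL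
  obtain ⟨n, hn, hle, hne⟩ := h (of G x 0) (of_ne_zero x 0)
  generalize of G x 0 = a at hx hle hne
  have hper : ∀ j : ℕ, G.act (-m * j) a = a := fun j => by
    induction j with
    | zero => simpa using act_zero a
    | succ j ih =>
      have : (-m * (j + 1 : ℕ) : ℤ) = -m * j + -m := by push_cast; ring
      rw [this, ← act_act, ← hx, ih]
  have hmul : ∀ j : ℕ, AlgLE a (G.act (n * j) a) := fun j => by
    induction j with
    | zero => exact ⟨0, by simpa using act_zero a⟩
    | succ j ih =>
      have h1 := act_le (n * j) hle
      rw [act_act] at h1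
      have : (n * (j + 1 : ℕ) : ℤ) = n * j + n := by push_cast; ring
      rw [this]
      exact algLE_trans ih h1
  refine hne (algLE_antisymm hG hle ?_)
  have h1 := act_le n (hmul (m - 1))
  rw [act_act] at h1
  -- The total shift `n * m` is a multiple of the period.
  have h2 : n + n * (m - 1 : ℕ) = -m * n.natAbs := by
    rw [Nat.cast_sub hm, Int.ofNat_natAbs_of_nonpos hn.le]
    push_cast
    ring
  rwa [h2, hper] at h1

end GrMonoid

end DirGraph

theorem corollary4p1 {V : Type u} {E : Type v} {F : Type w} [Field F] [Nonempty V]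
    (G : DirGraph V E) (hG : G.RowFinite) :
    (IsGradedSimple (DirGraph.LeavittPathAlgebra.component F G) ↔
      IsSimpleMonoid (Multiplicative ℤ) G.GrMonoid) ∧
    (IsSimpleRing (G.LeavittPathAlgebra F) ↔
      IsSimpleMonoid (Multiplicative ℤ) G.GrMonoid ∧
      ∀ a : G.GrMonoid, a ≠ 0 → ∀ n : ℤ, n < 0 →
        AlgComparable (G.act n a) a → AlgLT a (G.act n a)) ∧
    (IsPurelyInfiniteSimple (G.LeavittPathAlgebra F) ↔
      IsSimpleMonoid (Multiplicative ℤ) G.GrMonoid ∧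
      (∀ a : G.GrMonoid, a ≠ 0 → ∀ n : ℤ, n < 0 →
        AlgComparable (G.act n a) a → AlgLT a (G.act n a)) ∧
      ∃ a : G.GrMonoid, ∃ n : ℤ, n < 0 ∧ AlgLT a (G.act n a)) ∧
    (Finite V → Finite E →
      (IsPurelyInfiniteSimple (G.LeavittPathAlgebra F) ↔
        IsSimpleMonoid (Multiplicative ℤ) G.GrMonoid ∧
        ∀ a : G.GrMonoid, a ≠ 0 → ∃ n : ℤ, n < 0 ∧ AlgLT a (G.act n a))) := by
  rw [DirGraph.GrMonoid.isSimpleMonoid_iff hG, DirGraph.GrMonoid.algLT_act_neg_iff hG,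
    DirGraph.LeavittPathAlgebra.isPurelyInfiniteSimple_iff hG]
  refine ⟨DirGraph.LeavittPathAlgebra.isGradedSimple_iff hG,
    DirGraph.LeavittPathAlgebra.isSimpleRing_iff hG,
    and_congr_right fun _ => and_congr_right fun hL =>
      DirGraph.GrMonoid.exists_closedPath_iff hG hL,
    fun _ _ => and_congr_right fun hH => ⟨?_, fun h => ?_⟩⟩
  · rintro ⟨hL, hex⟩ a ha
    -- There are no sinks: every vertex reaches a closed path, hence emits an edge.
    obtain ⟨n, hn, hle⟩ := DirGraph.GrMonoid.exists_le_act_neg hG (fun x => by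
      obtain ⟨y, p, t, hp, ht, hne⟩ := DirGraph.reachesClosedPath_of_exists hH hex x
      cases hp with
      | nil =>
        cases ht with
        | nil => exact absurd rfl hne
        | @cons e _ _ _ => exact ⟨e, rfl⟩
      | @cons e _ _ _ => exact ⟨e, rfl⟩) a
    exact ⟨n, hn, (DirGraph.GrMonoid.algLT_act_neg_iff hG).2 hL a ha n hn (.inr hle)⟩
  · have hL := DirGraph.GrMonoid.closedPathsHaveExits_of_forall_exists hG h
    obtain ⟨x⟩ := ‹Nonempty V›
    exact ⟨hL, (DirGraph.GrMonoid.exists_closedPath_iff hG hL).2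
      ⟨_, h _ (DirGraph.GrMonoid.of_ne_zero x 0)⟩⟩
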